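/- **Setting.** Let $\Omega=[0,l_1]\times\dots\times[0,l_d]$ and let $\mathcal G=(\mathcal N,\mathcal E)$ be a connected finite graph without loops whose nodes are points of $\Omega$. Write $x\sim y$ for adjacency and $|\cdot|$ for the Euclidean norm. Let $\Gamma\subset\partial\Omega$, let $\hat V$ be the space of functions $\mathcal N\to\mathbb R$, $V=\{v\in\hat V: v=0 \text{ on }\mathcal N\cap\Gamma\}$, and, for $\omega\subset\mathbb R^d$, let $V(\omega)$ be the set of $v\in V$ that vanish at the nodes outside $\omega$. Put $$|v|_{M,\omega}^2=\sum_{x\in\mathcal N\cap\omega}\frac12\sum_{y\sim x}|x-y|\,v(x)^2,\qquad |v|_{L,\omega}^2=\sum_{x\in\mathcal N\cap\omega}\frac12\sum_{y\sim x}\frac{(v(x)-v(y))^2}{|x-y|}.$$ For $\mathbf v=(v_1,\dots,v_n)\in\hat V^n$ let $(\mathbf L\mathbf v,\mathbf v)=\sum_k|v_k|_{L,\Omega}^2$ and $(\mathbf u,\mathbf v)=\sum_k\sum_{x\in\mathcal N}u_k(x)v_k(x)$. Let $B_R(x)=\prod_i[x_i-R,x_i+R)$, where the $i$-th factor is replaced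 by the closed interval if $x_i+R=l_i$. **Mesh.** Let $H>0$ with $l_i=N_iH$, $N_i\in\mathbb N$. The mesh $\mathcal T_H$ is the partition of $\Omega$ into the boxes $B_{H/2}(x)$, $x\in\Omega$, $H^{-1}x_i+\frac12\in\mathbb Z$ for all $i$. Its vertices are $y_1,\dots,y_m$, and $U(y_j)$ is the union of the elements $T\in\mathcal T_H$ with $y_j\in\overline T$. Assume that $\Gamma$ is a union of (closed) element faces. Let $V_H$ be the space of restrictions to $\mathcal N$ of continuous functions on $\Omega$ that vanish on $\Gamma$ and on each element are linear combinations of the monomials $z^a$, $a\in\{0,1\}^d$. Put $\mathbf V=V^n$, $\mathbf V_0=V_H^n$ and $\mathbf V_j=V(U(y_j))^n$ for $j=1,\dots,m$. A decomposition of $\mathbf v\in\mathbf V$ is a representation $\mathbf v=\sum_{j=0}^m\mathbf v_j$ with $\mathbf v_j\in\mathbf V_j$. **Assumption 1 (operator).** $\mathbf K:\hat V^n\to\hat V^n$ is linear, symmetric and positive semi-definite; there are $\alpha>0$ and $\beta<\infty$ with $\alpha(\mathbf L\mathbf v,\mathbf v)\le(\mathbf K\mathbf v,\mathbf v)\le\beta(\mathbf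 L\mathbf v,\mathbf v)$ for all $\mathbf v\in\mathbf V$; and for each $\mathbf f\in\hat V^n$ there is a unique $\mathbf u\in\mathbf V$ with $(\mathbf K\mathbf u,\mathbf v)=(\mathbf f,\mathbf v)$ for all $\mathbf v\in\mathbf V$. Write $|\mathbf v|_{\mathbf K}^2=(\mathbf K\mathbf v,\mathbf v)$. **Assumption 2 (network).** There are $R_0>0$, $\rho>0$ and $\sigma$ such that 1. $\rho\le(2R)^{-d}|1|_{M,B_R(x)}^2\le\sigma\rho$ for all $R\ge R_0$ and $x\in\Omega$ with $B_R(x)\subset\Omega$; 2. for all $R\ge R_0$ and $x\in\Omega$ there is a connected subgraph of $\mathcal G$ that contains all edges with at least one endpoint in $B_R(x)$ and only edges with both endpoints in $B_{R+R_0}(x)$; 3. $|x-y|<R_0$ for all edges $\{x,y\}$; 4. for each $y\in\Gamma$ there is $x\in\mathcal N\cap\Gamma$ with $|x-y|<R_0$. **The constant $\mu$.** Call $\mu\ge0$ *admissible* if for all $R\ge R_0$ and $x\in\Omega$: $|v|_{M,B_R(x)}\le\mu R\,|v|_{L,B_{R+R_0}(x)}$ for all $v\in V$ whenever $B_R(x)$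 contains a node of $\Gamma$; and for each $v\in\hat V$ there is a constant $c$ with $|v-c|_{M,B_R(x)}\le\mu R\,|v|_{L,B_{R+R_0}(x)}$. **Lemma.** For each $d$ there is a constant $C_d>0$, depending only on $d$, with the following properties. If Assumption 2 holds, an admissible $\mu$ exists. If Assumptions 1 and 2 hold and $H\ge2R_0$, then: (i) for every admissible $\mu$, provided that the mesh has at least three elements in some coordinate direction ($N_i\ge3$ for some $i$) or $\mu\ge1$, each $\mathbf v\in\mathbf V$ has a decomposition with $$\sum_{j=0}^m|\mathbf v_j|_{\mathbf K}^2\le C_1|\mathbf v|_{\mathbf K}^2,\qquad C_1=C_d\,\beta\alpha^{-1}\sigma\mu^2;$$ (ii) every decomposition of every $\mathbf v\in\mathbf V$ satisfies $$|\mathbf v|_{\mathbf K}^2\le C_2\sum_{j=0}^m|\mathbf v_j|_{\mathbf K}^2,\qquad C_2=C_d\,\beta\alpha^{-1}.$$ -/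

import Mathlib

/-- Points of `ℝ^d` with the Euclidean norm. -/
abbrev Pt (d : ℕ) : Type := EuclideanSpace ℝ (Fin d)

/-- The closed hyper-rectangle `Ω = [0, l₁] × ⋯ × [0, l_d]`. -/
def rect {d : ℕ} (l : Fin d → ℝ) : Set (Pt d) :=
  {x | ∀ i, 0 ≤ x i ∧ x i ≤ l i}

/-- The box `B_R(x) = ∏ [x_i - R, x_i + R)`, where the `i`-th factor is replaced by the closed
interval `[x_i - R, x_i + R]` whenever `x_i + R = l_i`. -/
def box {d : ℕ} (l : Fin d → ℝ) (R : ℝ) (x : Pt d) : Set (Pt d) :=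
  {z | ∀ i, x i - R ≤ z i ∧ (z i < x i + R ∨ (x i + R = l i ∧ z i = l i))}

/-- Centres of the mesh elements: the points `x ∈ Ω` with `H⁻¹ x_i + 1/2 ∈ ℤ` for all `i`. -/
def centres {d : ℕ} (l : Fin d → ℝ) (H : ℝ) : Set (Pt d) :=
  {x | x ∈ rect l ∧ ∀ i, ∃ k : ℤ, H⁻¹ * x i + 1 / 2 = (k : ℝ)}

/-- The mesh `𝒯_H` of hypercubes of side length `H`. -/
def mesh {d : ℕ} (l : Fin d → ℝ) (H : ℝ) : Set (Set (Pt d)) :=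
  {T | ∃ x ∈ centres l H, T = box l (H / 2) x}

/-- The closed `(d-1)`-dimensional faces of the elements of the mesh `𝒯_H`. -/
def elementFaces {d : ℕ} (l : Fin d → ℝ) (H : ℝ) : Set (Set (Pt d)) :=
  {F | ∃ x ∈ centres l H, ∃ i : Fin d, ∃ s : ℝ, (s = x i - H / 2 ∨ s = x i + H / 2) ∧
    F = {z | z ∈ closure (box l (H / 2) x) ∧ z i = s}}

/-- The element patch `U(ω)`: the points of all elements whose closure meets the closure
of `ω`. -/
def patch {d : ℕ} (l : Fin d → ℝ) (H : ℝ) (ω : Set (Pt d)) : Set (Pt d) :=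
  {x | x ∈ rect l ∧ ∃ T ∈ mesh l H, x ∈ T ∧ (closure T ∩ closure ω).Nonempty}

/-- The mesh node with multi-index `k`, i.e. the point with coordinates `k_i H`. When
`l_i = N_i H`, these are all the vertices of the elements as `k` runs through
`∏ {0, …, N_i}`. -/
noncomputable def meshNode {d : ℕ} (H : ℝ) {N : Fin d → ℕ} (k : (i : Fin d) → Fin (N i + 1)) :
    Pt d :=
  WithLp.toLp 2 (fun i => ((k i : ℕ) : ℝ) * H)

/-- The finite element space `𝒬_H` with homogeneous boundary condition on `Γ`: functions that are
continuous on `Ω`, whose restriction to every element is a linear combination of the monomials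
`z^a` with all exponents `a_i ∈ {0, 1}` (the monomial of `S` is `∏ i ∈ S, z_i`), and which
vanish on `Γ`. -/
def IsFEFunction {d : ℕ} (l : Fin d → ℝ) (H : ℝ) (Γ : Set (Pt d)) (q : Pt d → ℝ) : Prop :=
  ContinuousOn q (rect l) ∧
  (∀ T ∈ mesh l H, ∃ a : Finset (Fin d) → ℝ, ∀ z ∈ T, q z = ∑ S, a S * ∏ i ∈ S, z i) ∧
  ∀ z ∈ Γ, q z = 0

/-- A connected spatial network in the hyper-rectangle `Ω`, with Dirichlet boundary part `Γ`. -/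
structure SpatialNetwork (d : ℕ) where
  /-- the side lengths `l_i` of `Ω` -/
  side : Fin d → ℝ
  side_pos : ∀ i, 0 < side i
  /-- the node set -/
  nodes : Finset (Pt d)
  nodes_subset : ∀ x ∈ nodes, x ∈ rect side
  /-- the edges -/
  graph : SimpleGraph nodes
  connected : graph.Connected
  /-- the Dirichlet part `Γ` of the boundary -/
  Γ : Set (Pt d)
  Γ_subset : Γ ⊆ frontier (rect side)

namespace SpatialNetwork

variable {d : ℕ} (G : SpatialNetwork d)

/-- The domain `Ω`. -/
abbrev Ω : Set (Pt d) := rect G.side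

/-- `B_R(x)`. -/
abbrev B (R : ℝ) (x : Pt d) : Set (Pt d) := box G.side R x

open Classical in
/-- `|v|_{M,ω}² = ∑_{x ∈ 𝒩(ω)} (1/2) ∑_{y ∼ x} |x - y| v(x)²`. -/
noncomputable def Msq (ω : Set (Pt d)) (v : G.nodes → ℝ) : ℝ :=
  ∑ x : G.nodes with x.1 ∈ ω, (1 / 2) * ∑ y : G.nodes with G.graph.Adj x y,
    dist x.1 y.1 * v x ^ 2

open Classical in
/-- `|v|_{L,ω}² = ∑_{x ∈ 𝒩(ω)} (1/2) ∑_{y ∼ x} (v(x) - v(y))² / |x - y|`. -/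
noncomputable def Lsq (ω : Set (Pt d)) (v : G.nodes → ℝ) : ℝ :=
  ∑ x : G.nodes with x.1 ∈ ω, (1 / 2) * ∑ y : G.nodes with G.graph.Adj x y,
    (v x - v y) ^ 2 / dist x.1 y.1

/-- The space `V` of functions on the nodes that vanish on the nodes in `Γ`. -/
def V : Submodule ℝ (G.nodes → ℝ) where
  carrier := {v | ∀ x : G.nodes, x.1 ∈ G.Γ → v x = 0}
  add_mem' := by
    intro a b ha hb x hx
    simp [ha x hx, hb x hx]
  zero_mem' := by
    intro x _
    rfl
  smul_mem' := by
    intro c a ha x hx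
    simp [ha x hx]

/-- The space `V(ω)` of functions in `V` that vanish at all nodes outside `ω`. -/
def VOn (ω : Set (Pt d)) : Submodule ℝ (G.nodes → ℝ) where
  carrier := {v | v ∈ G.V ∧ ∀ x : G.nodes, x.1 ∉ ω → v x = 0}
  add_mem' := by
    intro a b ha hb
    refine ⟨G.V.add_mem ha.1 hb.1, fun x hx => ?_⟩
    simp [ha.2 x hx, hb.2 x hx]
  zero_mem' := ⟨G.V.zero_mem, fun _ _ => rfl⟩
  smul_mem' := by
    intro c a ha
    refine ⟨G.V.smul_mem c ha.1, fun x hx => ?_⟩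
    simp [ha.2 x hx]

/-- The coarse space `V_H`: restrictions to the nodes of the finite element functions that
vanish on `Γ`. -/
def VCoarse (H : ℝ) : Submodule ℝ (G.nodes → ℝ) where
  carrier := {v | ∃ q : Pt d → ℝ, IsFEFunction G.side H G.Γ q ∧ ∀ x : G.nodes, v x = q x.1}
  add_mem' := by
    rintro a b ⟨p, ⟨hp1, hp2, hp3⟩, hp⟩ ⟨q, ⟨hq1, hq2, hq3⟩, hq⟩
    refine ⟨fun z => p z + q z, ⟨hp1.add hq1, fun T hT => ?_, fun z hz => ?_⟩, fun x => ?_⟩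
    · obtain ⟨s, hs⟩ := hp2 T hT
      obtain ⟨t, ht⟩ := hq2 T hT
      refine ⟨fun S => s S + t S, fun z hz => ?_⟩
      simp only [hs z hz, ht z hz, add_mul, Finset.sum_add_distrib]
    · simp [hp3 z hz, hq3 z hz]
    · simp [hp x, hq x]
  zero_mem' := by
    refine ⟨fun _ => 0, ⟨continuousOn_const, fun T _ => ⟨fun _ => 0, fun z _ => ?_⟩,
      fun _ _ => rfl⟩, fun _ => rfl⟩
    simp
  smul_mem' := by
    rintro c a ⟨p, ⟨hp1, hp2, hp3⟩, hp⟩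
    refine ⟨fun z => c * p z, ⟨continuousOn_const.mul hp1, fun T hT => ?_, fun z hz => ?_⟩,
      fun x => ?_⟩
    · obtain ⟨s, hs⟩ := hp2 T hT
      refine ⟨fun S => c * s S, fun z hz => ?_⟩
      simp only [hs z hz, Finset.mul_sum, mul_assoc]
    · simp [hp3 z hz]
    · simp [hp x]

/-- The space `W^n` of vector-valued functions all of whose components lie in `W`. -/
def vec (n : ℕ) (W : Submodule ℝ (G.nodes → ℝ)) : Submodule ℝ (Fin n → G.nodes → ℝ) :=
  Submodule.pi Set.univ (fun _ => W)

/-- The inner product `(u, v) = (u₁, v₁) + ⋯ + (u_n, v_n)`, `(u_k, v_k) = ∑_x u_k(x) v_k(x)`. -/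
def ip {n : ℕ} (u v : Fin n → G.nodes → ℝ) : ℝ :=
  ∑ k, ∑ x, u k x * v k x

/-- The quadratic form `(𝐋 v, v) = |v₁|_L² + ⋯ + |v_n|_L²`. -/
noncomputable def LsqVec {n : ℕ} (v : Fin n → G.nodes → ℝ) : ℝ :=
  ∑ k, G.Lsq G.Ω (v k)

/-- `|v|_K² = (K v, v)`. -/
def Ksq {n : ℕ} (K : (Fin n → G.nodes → ℝ) →ₗ[ℝ] (Fin n → G.nodes → ℝ))
    (v : Fin n → G.nodes → ℝ) : ℝ :=
  G.ip (K v) v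

/-- The assumptions on the operator `K`, with bounds `α` and `β`. -/
structure OperatorAssumptions {n : ℕ}
    (K : (Fin n → G.nodes → ℝ) →ₗ[ℝ] (Fin n → G.nodes → ℝ)) (α β : ℝ) : Prop where
  posSemidef : ∀ v, 0 ≤ G.ip (K v) v
  symm : ∀ v w, G.ip (K v) w = G.ip (K w) v
  alpha_pos : 0 < α
  coercive : ∀ v ∈ G.vec n G.V, α * G.LsqVec v ≤ G.ip (K v) v
  bounded : ∀ v ∈ G.vec n G.V, G.ip (K v) v ≤ β * G.LsqVec v
  unique_solution : ∀ f : Fin n → G.nodes → ℝ,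
    ∃! u : Fin n → G.nodes → ℝ, u ∈ G.vec n G.V ∧ ∀ v ∈ G.vec n G.V, G.ip (K u) v = G.ip f v

/-- The assumptions on the network, with length scale `R₀`, uniformity constant `σ` and
density `ρ`. Homogeneity is a condition on the boxes of side length `2R` that lie in `Ω`: it
cannot hold for boxes that stick out arbitrarily far. -/
structure NetworkAssumptions (R₀ σ ρ : ℝ) : Prop where
  R₀_pos : 0 < R₀
  ρ_pos : 0 < ρ
  homogeneity : ∀ R, R₀ ≤ R → ∀ x ∈ G.Ω, G.B R x ⊆ G.Ω →
    ρ ≤ ((2 * R) ^ d)⁻¹ * G.Msq (G.B R x) (fun _ => 1) ∧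
    ((2 * R) ^ d)⁻¹ * G.Msq (G.B R x) (fun _ => 1) ≤ σ * ρ
  connectivity : ∀ R, R₀ ≤ R → ∀ x ∈ G.Ω, ∃ S : G.graph.Subgraph, S.Connected ∧
    (∀ y z : G.nodes, G.graph.Adj y z → y.1 ∈ G.B R x → S.Adj y z) ∧
    (∀ y z : G.nodes, S.Adj y z → y.1 ∈ G.B (R + R₀) x ∧ z.1 ∈ G.B (R + R₀) x)
  locality : ∀ x y : G.nodes, G.graph.Adj x y → dist x.1 y.1 < R₀
  boundary_density : ∀ y ∈ G.Γ, ∃ x : G.nodes, x.1 ∈ G.Γ ∧ dist x.1 y < R₀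

/-- `μ` is a constant for which the Friedrichs inequality (on boxes containing boundary nodes)
and the Poincaré inequality (on all boxes) hold at all scales `R ≥ R₀`. -/
structure IsPoincareConstant (R₀ μ : ℝ) : Prop where
  nonneg : 0 ≤ μ
  friedrichs : ∀ R, R₀ ≤ R → ∀ x ∈ G.Ω, (∃ y : G.nodes, y.1 ∈ G.Γ ∧ y.1 ∈ G.B R x) →
    ∀ v ∈ G.V, G.Msq (G.B R x) v ≤ (μ * R) ^ 2 * G.Lsq (G.B (R + R₀) x) v
  poincare : ∀ R, R₀ ≤ R → ∀ x ∈ G.Ω, ∀ v : G.nodes → ℝ, ∃ c : ℝ,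
    G.Msq (G.B R x) (fun y => v y - c) ≤ (μ * R) ^ 2 * G.Lsq (G.B (R + R₀) x) v

/-- The mesh of size `H`, with `N_i` elements in direction `i`, exactly covers `Ω`, and is aligned
with `Γ`: the set `Γ` is a union of element faces. -/
structure IsMesh (H : ℝ) (N : Fin d → ℕ) : Prop where
  H_pos : 0 < H
  side_eq : ∀ i, G.side i = N i * H
  aligned : ∃ F ⊆ elementFaces G.side H, G.Γ = ⋃₀ F

/-- `v₀ + ∑_j v_j` is a decomposition of `v` with `v₀` in the coarse space `V_H^n` and `v_j`
in the local space `V(U(y_j))^n` for every mesh node `y_j`. -/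
structure IsDecomposition (H : ℝ) (N : Fin d → ℕ) {n : ℕ} (v v₀ : Fin n → G.nodes → ℝ)
    (w : ((i : Fin d) → Fin (N i + 1)) → Fin n → G.nodes → ℝ) : Prop where
  coarse : v₀ ∈ G.vec n (G.VCoarse H)
  loc : ∀ j, w j ∈ G.vec n (G.VOn (patch G.side H {meshNode H j}))
  sum_eq : v = v₀ + ∑ j, w j

end SpatialNetwork

/-!
The network is compared with the continuous finite element setting through the multilinear nodal
functions `φ_k`, which form a partition of unity on `Ω` and are Lipschitz with constant `d / H`.

For the stable decomposition, take for each mesh node `y_k` the box of radius `5H` around it and a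
constant `c_k` that is close to `v` there: `c_k = 0` if `y_k ∈ Γ` (Friedrichs inequality; a network
node in `Γ` is nearby), and otherwise the constant of the Poincaré inequality
(`exists_local_constants`). The coarse part is `v₀ = ∑ c_k φ_k` and the local parts are
`φ_k (v - v₀)`. The constants at neighbouring mesh nodes are close, as both are close to `v` on a
common element, whose mass is at least `ρ H^d` (`sq_sub_local_constants_le`). Since the mass of a
patch is at most a multiple of `σ ρ H^d`, the energy of `v₀` is at most a multiple of
`σ μ² |v|_L²` (`Lsq_interp_le`), and `|v - v₀|_M²` is at most a multiple of `μ² H² |v|_L²`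
(`Msq_sub_interp_le`). The product rule for differences then controls the local parts
(`sum_Lsq_nodal_mul_le`). This leaves terms without the factor `σ μ²`; they are absorbed because
`σ μ²` is bounded below by a constant depending only on `d`. When there are three elements in a row,
this follows from the Poincaré inequality for a coordinate function (`one_le_of_three_le`).

Conversely, along an edge only boundedly many local parts are nonzero, so the energy of a sum is
bounded by the sum of the energies (`Lsq_add_sum_le`). The existence of a Poincaré constant holds
since any two nodes of a connected finite graph are joined by a path with at most `#𝒩` edges
(`Msq_sub_le`).

Neighbourhoods are measured in multiples of `H` in the maximum norm. All overlaps are counted with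
the single bound `15^d` for multi-indices within distance `7` (`card_near_le`).
-/

/-! ### Multilinear nodal functions -/

/-- The one-dimensional hat function `t ↦ max 0 (1 - |t|)`. -/
def hat (t : ℝ) : ℝ := max 0 (1 - |t|)

theorem hat_nonneg (t : ℝ) : 0 ≤ hat t := le_max_left _ _

theorem hat_le_one (t : ℝ) : hat t ≤ 1 :=
  max_le zero_le_one (by linarith [abs_nonneg t])

theorem hat_eq_zero {t : ℝ} (h : 1 ≤ |t|) : hat t = 0 :=
  max_eq_left (by linarith)

theorem hat_of_abs_le {t : ℝ} (h : |t| ≤ 1) : hat t = 1 - |t| :=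
  max_eq_right (by linarith)

theorem abs_hat_sub_le (s t : ℝ) : |hat s - hat t| ≤ |s - t| := by
  have h := abs_max_sub_max_le_abs (1 - |s|) (1 - |t|) 0
  rw [max_comm (1 - |s|), max_comm (1 - |t|)] at h
  refine h.trans ?_
  rw [show 1 - |s| - (1 - |t|) = |t| - |s| by ring, abs_sub_comm s t]
  exact abs_abs_sub_abs_le _ _

theorem continuous_hat : Continuous hat :=
  continuous_const.max (continuous_const.sub continuous_abs)

/-- A hat function with integer centre is affine between consecutive integers. -/
theorem hat_affine (m k : ℤ) :
    ∃ a b : ℝ, ∀ t : ℝ, (m : ℝ) ≤ t → t ≤ m + 1 → hat (t - k) = a + b * t := by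
  rcases lt_trichotomy m k with h | h | h
  · rcases (show m + 1 ≤ k from h).eq_or_lt with h' | h'
    · refine ⟨1 - k, 1, fun t h1 h2 => ?_⟩
      have hk : (k : ℝ) = m + 1 := by exact_mod_cast h'.symm
      rw [hat_of_abs_le (abs_le.2 ⟨by linarith, by linarith⟩), abs_of_nonpos (by linarith)]
      ring
    · refine ⟨0, 0, fun t h1 h2 => ?_⟩
      have hk : (m : ℝ) + 2 ≤ k := by exact_mod_cast (show m + 2 ≤ k by omega)
      rw [hat_eq_zero (by rw [abs_of_nonpos (by linarith)]; linarith)]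
      ring
  · refine ⟨1 + k, -1, fun t h1 h2 => ?_⟩
    have hk : (k : ℝ) = m := by exact_mod_cast h.symm
    rw [hat_of_abs_le (abs_le.2 ⟨by linarith, by linarith⟩), abs_of_nonneg (by linarith)]
    ring
  · refine ⟨0, 0, fun t h1 h2 => ?_⟩
    have hk : (k : ℝ) + 1 ≤ m := by exact_mod_cast (show k + 1 ≤ m by omega)
    rw [hat_eq_zero (by rw [abs_of_nonneg (by linarith)]; linarith)]
    ring

theorem sum_hat (n : ℕ) {t : ℝ} (h0 : 0 ≤ t) (hn : t ≤ n) :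
    ∑ m : Fin (n + 1), hat (t - ((m : ℕ) : ℝ)) = 1 := by
  rw [Fin.sum_univ_eq_sum_range (fun m : ℕ => hat (t - (m : ℝ))) (n + 1)]
  induction n with
  | zero =>
    have : t = 0 := le_antisymm (by simpa using hn) h0
    simp [this, hat]
  | succ n ih =>
    rw [Finset.sum_range_succ]
    by_cases h : t ≤ n
    · rw [ih h, hat_eq_zero, add_zero]
      push_cast
      rw [abs_of_nonpos (by linarith)]
      linarith
    · push Not at h
      push_cast at hn
      rw [Finset.sum_range_succ, Finset.sum_eq_zero, zero_add,
        hat_of_abs_le (by rw [abs_of_pos (by linarith)]; linarith),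
        hat_of_abs_le (by push_cast; rw [abs_of_nonpos (by linarith)]; linarith),
        abs_of_pos (by linarith), abs_of_nonpos (by push_cast; linarith)]
      · push_cast
        ring
      · intro m hm
        have : (m : ℝ) + 1 ≤ n := by exact_mod_cast Finset.mem_range.1 hm
        refine hat_eq_zero ?_
        rw [abs_of_pos (by linarith)]
        linarith

theorem abs_prod_sub_prod_le {ι : Type*} (s : Finset ι) (f g : ι → ℝ)
    (hf : ∀ i, |f i| ≤ 1) (hg : ∀ i, |g i| ≤ 1) :
    |∏ i ∈ s, f i - ∏ i ∈ s, g i| ≤ ∑ i ∈ s, |f i - g i| := by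
  classical
  induction s using Finset.induction_on with
  | empty => simp
  | insert a s ha ih =>
    rw [Finset.prod_insert ha, Finset.prod_insert ha, Finset.sum_insert ha]
    have hp : |∏ i ∈ s, f i| ≤ 1 := by
      rw [Finset.abs_prod]
      exact Finset.prod_le_one (fun _ _ => abs_nonneg _) (fun i _ => hf i)
    calc |f a * ∏ i ∈ s, f i - g a * ∏ i ∈ s, g i|
        = |(f a - g a) * ∏ i ∈ s, f i + g a * (∏ i ∈ s, f i - ∏ i ∈ s, g i)| := by
          congr 1
          ring
      _ ≤ |f a - g a| * |∏ i ∈ s, f i| + |g a| * |∏ i ∈ s, f i - ∏ i ∈ s, g i| := by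
          rw [← abs_mul, ← abs_mul]
          exact abs_add_le _ _
      _ ≤ |f a - g a| * 1 + 1 * ∑ i ∈ s, |f i - g i| := by
          gcongr
          exact hg a
      _ = _ := by ring

/-- The multilinear nodal basis function of the mesh node with multi-index `k`. -/
noncomputable def nodal {d : ℕ} (H : ℝ) {N : Fin d → ℕ} (k : (i : Fin d) → Fin (N i + 1))
    (z : Pt d) : ℝ :=
  ∏ i, hat (z i / H - ((k i : ℕ) : ℝ))

section Nodal

variable {d : ℕ} {H : ℝ} {N : Fin d → ℕ} (k : (i : Fin d) → Fin (N i + 1))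

theorem nodal_nonneg (z : Pt d) : 0 ≤ nodal H k z :=
  Finset.prod_nonneg fun _ _ => hat_nonneg _

theorem nodal_le_one (z : Pt d) : nodal H k z ≤ 1 :=
  Finset.prod_le_one (fun _ _ => hat_nonneg _) fun _ _ => hat_le_one _

theorem abs_lt_one_of_nodal_ne_zero {k : (i : Fin d) → Fin (N i + 1)} {z : Pt d}
    (h : nodal H k z ≠ 0) (i : Fin d) : |z i / H - ((k i : ℕ) : ℝ)| < 1 := by
  by_contra! hc
  exact h (Finset.prod_eq_zero (Finset.mem_univ i) (hat_eq_zero hc))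

theorem abs_nodal_sub_le (hH : 0 < H) (x y : Pt d) :
    |nodal H k x - nodal H k y| ≤ d * dist x y / H := by
  have h1 : ∀ t, |hat t| ≤ 1 := fun t => by
    rw [abs_of_nonneg (hat_nonneg t)]
    exact hat_le_one t
  refine (abs_prod_sub_prod_le _ _ _ (fun i => h1 _) (fun i => h1 _)).trans ?_
  calc ∑ i, |hat (x i / H - ((k i : ℕ) : ℝ)) - hat (y i / H - ((k i : ℕ) : ℝ))|
      ≤ ∑ _i : Fin d, dist x y / H := by
        refine Finset.sum_le_sum fun i _ => (abs_hat_sub_le _ _).trans ?_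
        rw [show x i / H - ((k i : ℕ) : ℝ) - (y i / H - ((k i : ℕ) : ℝ)) = (x i - y i) / H by ring,
          abs_div, abs_of_pos hH]
        gcongr
        have := PiLp.norm_apply_le (x - y) i
        rwa [← dist_eq_norm] at this
    _ = d * dist x y / H := by
        simp
        ring

theorem sum_nodal (hH : 0 < H) {z : Pt d} (hz : z ∈ rect (fun i => N i * H)) :
    ∑ k : (i : Fin d) → Fin (N i + 1), nodal H k z = 1 := by
  unfold nodal
  rw [← Fintype.prod_sum (fun i (m : Fin (N i + 1)) => hat (z i / H - ((m : ℕ) : ℝ)))]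
  refine Finset.prod_eq_one fun i _ => sum_hat _ (div_nonneg (hz i).1 hH.le) ?_
  rw [div_le_iff₀ hH]
  exact (hz i).2

theorem continuous_nodal : Continuous (nodal H k) :=
  continuous_finsetProd _ fun i _ => continuous_hat.comp (by fun_prop)

end Nodal

/-! ### Boxes, cells and mesh nodes -/

section Geometry

variable {d : ℕ} {l : Fin d → ℝ} {H : ℝ} {N : Fin d → ℕ}

theorem mem_box_of_abs_lt {R : ℝ} {x z : Pt d} (h : ∀ i, |z i - x i| < R) : z ∈ box l R x :=
  fun i => ⟨by linarith [(abs_lt.1 (h i)).1], Or.inl (by linarith [(abs_lt.1 (h i)).2])⟩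

theorem abs_sub_le_of_mem_box {R : ℝ} {x z : Pt d} (h : z ∈ box l R x) (i : Fin d) :
    |z i - x i| ≤ R := by
  obtain ⟨h1, h2 | ⟨h2, h3⟩⟩ := h i <;> exact abs_le.2 ⟨by linarith, by linarith⟩

theorem abs_sub_le_of_mem_closure_box {R : ℝ} {x z : Pt d} (h : z ∈ closure (box l R x))
    (i : Fin d) : |z i - x i| ≤ R := by
  have hc : IsClosed {z : Pt d | |z i - x i| ≤ R} :=
    isClosed_le (by fun_prop) continuous_const
  exact closure_minimal (fun z hz => abs_sub_le_of_mem_box hz i) hc h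

theorem mem_closure_box {R : ℝ} (hR : 0 < R) {x z : Pt d} (h : ∀ i, |z i - x i| ≤ R) :
    z ∈ closure (box l R x) := by
  have ht : Filter.Tendsto (fun t : ℝ => x + t • (z - x)) (nhdsWithin 1 (Set.Iio 1)) (nhds z) := by
    have : Continuous fun t : ℝ => x + t • (z - x) := by fun_prop
    have h1 := this.tendsto 1
    simp only [one_smul, add_sub_cancel] at h1
    exact h1.mono_left nhdsWithin_le_nhds
  refine mem_closure_of_tendsto ht ?_
  filter_upwards [Ioo_mem_nhdsLT (show (0 : ℝ) < 1 by norm_num)] with t ht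
  refine mem_box_of_abs_lt fun i => ?_
  have : (x + t • (z - x)) i - x i = t * (z i - x i) := by simp
  rw [this, abs_mul, abs_of_pos ht.1]
  nlinarith [h i, abs_nonneg (z i - x i), ht.1, ht.2]

/-- If the nodal function of a mesh node does not vanish at a point of a closed element, then
this mesh node is a vertex of the element: it has distance `H / 2` from the centre in every
coordinate direction. -/
theorem abs_meshNode_sub_centre (hH : 0 < H) {c z : Pt d} (hc : c ∈ centres l H)
    (hz : z ∈ closure (box l (H / 2) c)) {k : (i : Fin d) → Fin (N i + 1)}
    (hk : nodal H k z ≠ 0) (i : Fin d) : |meshNode H k i - c i| = H / 2 := by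
  obtain ⟨m, hm⟩ := hc.2 i
  have h1 := abs_lt.1 (abs_lt_one_of_nodal_ne_zero hk i)
  have h2 := abs_le.1 (abs_sub_le_of_mem_closure_box hz i)
  have hci : c i = (m - 1 / 2) * H := by
    field_simp at hm
    linarith
  have hzi : z i = z i / H * H := by field_simp
  set t := z i / H
  rw [hzi, hci] at h2
  have h3 : (m : ℝ) - 1 ≤ t := by nlinarith
  have h4 : t ≤ m := by nlinarith
  have h5 : m - 1 < ((k i : ℕ) : ℤ) + 1 := by
    have : (m : ℝ) - 1 < ((k i : ℕ) : ℝ) + 1 := by linarith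
    exact_mod_cast this
  have h6 : ((k i : ℕ) : ℤ) - 1 < m := by
    have : ((k i : ℕ) : ℝ) - 1 < m := by linarith
    exact_mod_cast this
  have h7 : m - 1 = ((k i : ℕ) : ℤ) ∨ m = ((k i : ℕ) : ℤ) := by omega
  have h8 : meshNode H k i = ((k i : ℕ) : ℝ) * H := rfl
  rw [h8, hci]
  rcases h7 with h7 | h7
  · have h9 : (m : ℝ) - 1 = ((k i : ℕ) : ℝ) := by exact_mod_cast h7
    rw [← h9, show ((m : ℝ) - 1) * H - (m - 1 / 2) * H = -(H / 2) by ring, abs_neg,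
      abs_of_pos (by linarith)]
  · have h9 : (m : ℝ) = ((k i : ℕ) : ℝ) := by exact_mod_cast h7
    rw [← h9, show (m : ℝ) * H - (m - 1 / 2) * H = H / 2 by ring, abs_of_pos (by linarith)]

theorem meshNode_mem_closure (hH : 0 < H) {c z : Pt d} (hc : c ∈ centres l H)
    (hz : z ∈ closure (box l (H / 2) c)) {k : (i : Fin d) → Fin (N i + 1)}
    (hk : nodal H k z ≠ 0) : meshNode H k ∈ closure (box l (H / 2) c) :=
  mem_closure_box (by linarith) fun i => (abs_meshNode_sub_centre hH hc hz hk i).le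

/-- A nodal function of a mesh node that lies on no face in `F` is a finite element function
that vanishes on the faces in `F`. -/
theorem isFEFunction_nodal (hH : 0 < H) {F : Set (Set (Pt d))} (hF : F ⊆ elementFaces l H)
    (k : (i : Fin d) → Fin (N i + 1)) (hk : meshNode H k ∉ ⋃₀ F) :
    IsFEFunction l H (⋃₀ F) (nodal H k) := by
  refine ⟨(continuous_nodal k).continuousOn, ?_, ?_⟩
  · rintro T ⟨c, hc, rfl⟩
    choose m hm using hc.2
    choose a b hab using fun i => hat_affine (m i - 1) ((k i : ℕ) : ℤ)
    refine ⟨fun S => (∏ i ∈ S, b i / H) * ∏ i ∈ Finset.univ \ S, a i, fun z hz => ?_⟩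
    have h : nodal H k z = ∏ i, (b i / H * z i + a i) := by
      refine Finset.prod_congr rfl fun i _ => ?_
      have h2 := abs_le.1 (abs_sub_le_of_mem_box hz i)
      have hci : c i = (m i - 1 / 2) * H := by
        have := hm i
        field_simp at this
        linarith
      have := hab i (z i / H)
        (by rw [le_div_iff₀ hH]; push_cast; linarith)
        (by rw [div_le_iff₀ hH]; push_cast; linarith)
      push_cast at this
      rw [this]
      ring
    rw [h, Finset.prod_add, Finset.powerset_univ]
    refine Finset.sum_congr rfl fun S _ => ?_
    rw [Finset.prod_mul_distrib]
    ring
  · rintro z ⟨f, hf, hz⟩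
    obtain ⟨c, hc, i, s, hs, rfl⟩ := hF hf
    by_contra hne
    refine hk ⟨_, hf, meshNode_mem_closure hH hc hz.1 hne, ?_⟩
    have h1 := abs_lt.1 (abs_lt_one_of_nodal_ne_zero hne i)
    have h2 := abs_meshNode_sub_centre hH hc hz.1 hne i
    have h3 : |z i - meshNode H k i| < H := by
      have h8 : meshNode H k i = ((k i : ℕ) : ℝ) * H := rfl
      have hzi : z i = z i / H * H := by field_simp
      rw [h8, abs_lt]
      constructor <;> nlinarith
    have h4 : z i = s := hz.2
    -- both coordinates belong to `{c i - H / 2, c i + H / 2}` and differ by less than `H`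
    have h5 := abs_lt.1 h3
    rcases (abs_eq (by linarith)).1 h2 with h6 | h6 <;> rcases hs with h7 | h7 <;> linarith

/-- The centre of the element with corner `(k_i H)_i`. -/
noncomputable def cellCentre (H : ℝ) (k : (i : Fin d) → Fin (N i)) : Pt d :=
  WithLp.toLp 2 (fun i => (((k i : ℕ) : ℝ) + 1 / 2) * H)

/-- The element with corner `(k_i H)_i`. -/
def cell (l : Fin d → ℝ) (H : ℝ) (k : (i : Fin d) → Fin (N i)) : Set (Pt d) :=
  box l (H / 2) (cellCentre H k)

theorem cellCentre_mem_centres (hH : 0 < H) (hl : ∀ i, l i = N i * H)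
    (k : (i : Fin d) → Fin (N i)) : cellCentre H k ∈ centres l H := by
  have hi : ∀ i, cellCentre H k i = (((k i : ℕ) : ℝ) + 1 / 2) * H := fun _ => rfl
  refine ⟨fun i => ?_, fun i => ⟨(k i : ℕ) + 1, ?_⟩⟩
  · rw [hi, hl]
    have : ((k i : ℕ) : ℝ) + 1 ≤ N i := by exact_mod_cast (k i).2
    constructor
    · positivity
    · gcongr
      linarith
  · rw [hi]
    field_simp
    push_cast
    ring

theorem bounds_of_mem_cell {k : (i : Fin d) → Fin (N i)} {z : Pt d} (hz : z ∈ cell l H k)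
    (i : Fin d) : ((k i : ℕ) : ℝ) * H ≤ z i ∧ z i ≤ (((k i : ℕ) : ℝ) + 1) * H := by
  have h := abs_le.1 (abs_sub_le_of_mem_box hz i)
  have hi : cellCentre H k i = (((k i : ℕ) : ℝ) + 1 / 2) * H := rfl
  rw [hi] at h
  constructor <;> linarith

theorem cell_subset_rect (hH : 0 < H) (hl : ∀ i, l i = N i * H)
    (k : (i : Fin d) → Fin (N i)) : cell l H k ⊆ rect l := by
  intro z hz i
  have h := bounds_of_mem_cell hz i
  have : ((k i : ℕ) : ℝ) + 1 ≤ N i := by exact_mod_cast (k i).2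
  refine ⟨le_trans (by positivity) h.1, h.2.trans ?_⟩
  rw [hl]
  gcongr

theorem exists_mem_cell (hH : 0 < H) (hN : ∀ i, 0 < N i) (hl : ∀ i, l i = N i * H) {z : Pt d}
    (hz : z ∈ rect l) : ∃ k : (i : Fin d) → Fin (N i), z ∈ cell l H k := by
  refine ⟨fun i => ⟨min ⌊z i / H⌋₊ (N i - 1), by have := hN i; omega⟩, fun i => ?_⟩
  have h0 : 0 ≤ z i / H := div_nonneg (hz i).1 hH.le
  have hzi : z i = z i / H * H := by field_simp
  have hN1 : ((N i - 1 : ℕ) : ℝ) = N i - 1 := by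
    rw [Nat.cast_sub (hN i)]
    simp
  have hzl : z i ≤ N i * H := hl i ▸ (hz i).2
  change ((min ⌊z i / H⌋₊ (N i - 1) : ℕ) + 1 / 2 : ℝ) * H - H / 2 ≤ z i ∧
    (z i < ((min ⌊z i / H⌋₊ (N i - 1) : ℕ) + 1 / 2 : ℝ) * H + H / 2 ∨
    (((min ⌊z i / H⌋₊ (N i - 1) : ℕ) + 1 / 2 : ℝ) * H + H / 2 = l i ∧ z i = l i))
  rw [hl i]
  rcases le_total ⌊z i / H⌋₊ (N i - 1) with h | h
  · rw [min_eq_left h]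
    have h1 := Nat.floor_le h0
    have h2 := Nat.lt_floor_add_one (z i / H)
    exact ⟨by nlinarith, Or.inl (by nlinarith)⟩
  · rw [min_eq_right h, hN1]
    have h1 : (N i : ℝ) - 1 ≤ z i / H := by
      rw [← hN1]
      exact (Nat.cast_le.2 h).trans (Nat.floor_le h0)
    refine ⟨by nlinarith, ?_⟩
    rcases hzl.eq_or_lt with h2 | h2
    · exact Or.inr ⟨by ring, h2⟩
    · exact Or.inl (by linarith)

theorem mem_patch_of_nodal_ne_zero (hH : 0 < H) (hN : ∀ i, 0 < N i) (hl : ∀ i, l i = N i * H)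
    {z : Pt d} (hz : z ∈ rect l) {k : (i : Fin d) → Fin (N i + 1)} (hk : nodal H k z ≠ 0) :
    z ∈ patch l H {meshNode H k} := by
  obtain ⟨m, hm⟩ := exists_mem_cell hH hN hl hz
  have hc := cellCentre_mem_centres hH hl m
  exact ⟨hz, cell l H m, ⟨_, hc, rfl⟩, hm, meshNode H k,
    meshNode_mem_closure hH hc (subset_closure hm) hk, subset_closure rfl⟩

theorem abs_sub_le_of_mem_patch (hH : 0 < H) {z : Pt d} {k : (i : Fin d) → Fin (N i + 1)}
    (hz : z ∈ patch l H {meshNode H k}) (i : Fin d) : |z i / H - ((k i : ℕ) : ℝ)| ≤ 1 := by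
  obtain ⟨-, T, ⟨c, -, rfl⟩, hzT, y, hy, hyk⟩ := hz
  rw [closure_singleton, Set.mem_singleton_iff] at hyk
  subst hyk
  have h1 := abs_le.1 (abs_sub_le_of_mem_box hzT i)
  have h2 := abs_le.1 (abs_sub_le_of_mem_closure_box hy i)
  have h8 : meshNode H k i = ((k i : ℕ) : ℝ) * H := rfl
  rw [h8] at h2
  rw [abs_le]
  constructor
  · rw [le_sub_iff_add_le, le_div_iff₀ hH]
    linarith
  · rw [sub_le_iff_le_add, div_le_iff₀ hH]
    linarith

theorem meshNode_mem_rect (hH : 0 < H) (hl : ∀ i, l i = N i * H)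
    (k : (i : Fin d) → Fin (N i + 1)) : meshNode H k ∈ rect l := by
  intro i
  have h8 : meshNode H k i = ((k i : ℕ) : ℝ) * H := rfl
  have : ((k i : ℕ) : ℝ) ≤ N i := by exact_mod_cast Nat.lt_succ_iff.1 (k i).2
  rw [h8, hl]
  exact ⟨by positivity, by gcongr⟩

/-- At most `15^d` multi-indices have sup-distance at most `7` from a given point. -/
theorem card_near_le (n : Fin d → ℕ) (t : Fin d → ℝ)
    (p : ((i : Fin d) → Fin (n i)) → Prop) [DecidablePred p]
    (hp : ∀ k, p k → ∀ i, |t i - ((k i : ℕ) : ℝ)| ≤ 7) :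
    (((Finset.univ.filter p).card : ℕ) : ℝ) ≤ 15 ^ d := by
  classical
  have h1 : ∀ i, (Finset.univ.filter fun m : Fin (n i) => |t i - ((m : ℕ) : ℝ)| ≤ 7).card ≤ 15 := by
    intro i
    have hinj : Function.Injective fun m : Fin (n i) => ((m : ℕ) : ℤ) := fun a b h => by
      simpa [Fin.ext_iff] using h
    rw [← Finset.card_map ⟨_, hinj⟩]
    refine (Finset.card_le_card (t := Finset.Icc ⌈t i - 7⌉ ⌊t i + 7⌋) ?_).trans ?_
    · intro a ha
      simp only [Finset.mem_map, Finset.mem_filter, Finset.mem_univ, true_and,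
        Function.Embedding.coeFn_mk] at ha
      obtain ⟨m, hm, rfl⟩ := ha
      rw [abs_le] at hm
      rw [Finset.mem_Icc, Int.ceil_le, Int.le_floor]
      push_cast
      constructor <;> linarith
    · rw [Int.card_Icc]
      have h2 := Int.floor_le (t i + 7)
      have h3 := Int.le_ceil (t i - 7)
      have : ⌊t i + 7⌋ - ⌈t i - 7⌉ ≤ 14 := by
        have : ((⌊t i + 7⌋ - ⌈t i - 7⌉ : ℤ) : ℝ) ≤ (14 : ℤ) := by
          push_cast
          linarith
        exact_mod_cast this
      omega
  have h2 : Finset.univ.filter p ⊆ Fintype.piFinset fun i =>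
      Finset.univ.filter fun m : Fin (n i) => |t i - ((m : ℕ) : ℝ)| ≤ 7 := by
    intro k hk
    simpa using hp k (Finset.mem_filter.1 hk).2
  have h3 := (Finset.card_le_card h2).trans_eq (Fintype.card_piFinset _)
  have h4 : ∏ i, (Finset.univ.filter fun m : Fin (n i) => |t i - ((m : ℕ) : ℝ)| ≤ 7).card
      ≤ 15 ^ d := by
    refine (Finset.prod_le_prod' fun i _ => h1 i).trans ?_
    simp
  exact_mod_cast h3.trans h4

end Geometry

/-! ### Node weights and edge energies -/

namespace SpatialNetwork

open Classical

variable {d : ℕ} (G : SpatialNetwork d)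

/-- The mass `(1/2) ∑_{y ∼ x} |x - y|` of the node `x`. -/
noncomputable def weight (x : G.nodes) : ℝ :=
  (1 / 2) * ∑ y : G.nodes with G.graph.Adj x y, dist x.1 y.1

/-- The contribution `(1/2) ∑_{y ∼ x} (v(x) - v(y))² / |x - y|` of the node `x` to `|v|_L²`. -/
noncomputable def edgeEnergy (v : G.nodes → ℝ) (x : G.nodes) : ℝ :=
  (1 / 2) * ∑ y : G.nodes with G.graph.Adj x y, (v x - v y) ^ 2 / dist x.1 y.1

theorem weight_nonneg (x : G.nodes) : 0 ≤ G.weight x :=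
  mul_nonneg (by norm_num) (Finset.sum_nonneg fun _ _ => dist_nonneg)

theorem edgeEnergy_nonneg (v : G.nodes → ℝ) (x : G.nodes) : 0 ≤ G.edgeEnergy v x :=
  mul_nonneg (by norm_num) (Finset.sum_nonneg fun _ _ => div_nonneg (sq_nonneg _) dist_nonneg)

theorem Msq_eq (ω : Set (Pt d)) (v : G.nodes → ℝ) :
    G.Msq ω v = ∑ x : G.nodes with x.1 ∈ ω, G.weight x * v x ^ 2 := by
  refine Finset.sum_congr rfl fun x _ => ?_
  rw [weight, ← Finset.sum_mul, mul_assoc]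

theorem Msq_one (ω : Set (Pt d)) :
    G.Msq ω (fun _ => 1) = ∑ x : G.nodes with x.1 ∈ ω, G.weight x := by
  simp [Msq_eq]

theorem Lsq_eq (ω : Set (Pt d)) (v : G.nodes → ℝ) :
    G.Lsq ω v = ∑ x : G.nodes with x.1 ∈ ω, G.edgeEnergy v x := rfl

theorem Lsq_nonneg (ω : Set (Pt d)) (v : G.nodes → ℝ) : 0 ≤ G.Lsq ω v :=
  Finset.sum_nonneg fun _ _ => G.edgeEnergy_nonneg _ _

theorem Lsq_domain (v : G.nodes → ℝ) : G.Lsq G.Ω v = ∑ x, G.edgeEnergy v x := by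
  rw [Lsq_eq, Finset.filter_true_of_mem fun x _ => G.nodes_subset x.1 x.2]

variable {G}

theorem dist_pos_of_adj {x y : G.nodes} (h : G.graph.Adj x y) : 0 < dist x.1 y.1 :=
  dist_pos.2 fun e => h.ne (Subtype.ext e)

/-- A pointwise bound for the energy of a family of functions along the edges at `x` gives a
bound for the sum of the energies at `x`. -/
theorem sum_edgeEnergy_le {ι : Type*} (s : Finset ι) (w : ι → G.nodes → ℝ) (v : G.nodes → ℝ)
    (x : G.nodes) (a b : ℝ) (h : ∀ y, G.graph.Adj x y →
      ∑ k ∈ s, (w k x - w k y) ^ 2 ≤ a * (v x - v y) ^ 2 + b * dist x.1 y.1 ^ 2) :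
    ∑ k ∈ s, G.edgeEnergy (w k) x ≤ a * G.edgeEnergy v x + b * G.weight x := by
  unfold edgeEnergy weight
  rw [← Finset.mul_sum, Finset.sum_comm]
  calc (1 / 2 : ℝ) * ∑ y : G.nodes with G.graph.Adj x y,
        ∑ k ∈ s, (w k x - w k y) ^ 2 / dist x.1 y.1
      ≤ 1 / 2 * ∑ y : G.nodes with G.graph.Adj x y,
        (a * ((v x - v y) ^ 2 / dist x.1 y.1) + b * dist x.1 y.1) := by
        refine mul_le_mul_of_nonneg_left (Finset.sum_le_sum fun y hy => ?_) (by norm_num)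
        have hxy := (Finset.mem_filter.1 hy).2
        have hd := dist_pos_of_adj hxy
        rw [← Finset.sum_div, div_le_iff₀ hd]
        refine (h y hxy).trans_eq ?_
        field_simp
    _ = _ := by
        rw [Finset.sum_add_distrib, ← Finset.mul_sum, ← Finset.mul_sum]
        ring

theorem edgeEnergy_le (u v : G.nodes → ℝ) (x : G.nodes) (a b : ℝ)
    (h : ∀ y, G.graph.Adj x y →
      (u x - u y) ^ 2 ≤ a * (v x - v y) ^ 2 + b * dist x.1 y.1 ^ 2) :
    G.edgeEnergy u x ≤ a * G.edgeEnergy v x + b * G.weight x := by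
  simpa using sum_edgeEnergy_le Finset.univ (fun _ : Unit => u) v x a b (by simpa using h)

/-! ### Existence of a Poincaré constant -/

theorem abs_sub_le_of_walk {W : Type*} {g : SimpleGraph W} {f : W → ℝ} {D : ℝ}
    (h : ∀ a b, g.Adj a b → |f a - f b| ≤ D) {a b : W} (p : g.Walk a b) :
    |f a - f b| ≤ D * p.length := by
  induction p with
  | nil => simp
  | @cons a b c hab p ih =>
    rw [SimpleGraph.Walk.length_cons]
    push_cast
    have := abs_sub_le (f a) (f b) (f c)
    linarith [h a b hab]

theorem abs_sub_le_of_connected {W : Type*} [Fintype W] {g : SimpleGraph W} (hg : g.Connected)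
    {f : W → ℝ} {D : ℝ} (hD : 0 ≤ D) (h : ∀ a b, g.Adj a b → |f a - f b| ≤ D) (a b : W) :
    |f a - f b| ≤ D * Fintype.card W := by
  obtain ⟨p, hp⟩ := (hg.preconnected a b).exists_isPath
  refine (abs_sub_le_of_walk h p).trans ?_
  gcongr
  exact hp.length_lt.le

theorem sq_sub_le_of_adj {R₀ σ ρ : ℝ} (h : G.NetworkAssumptions R₀ σ ρ) {ω : Set (Pt d)}
    (v : G.nodes → ℝ) {a b : G.nodes} (hab : G.graph.Adj a b) (ha : a.1 ∈ ω) :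
    (v a - v b) ^ 2 ≤ 2 * R₀ * G.Lsq ω v := by
  have h1 : G.edgeEnergy v a ≤ G.Lsq ω v := by
    rw [Lsq_eq]
    exact Finset.single_le_sum (fun x _ => G.edgeEnergy_nonneg v x) (by simp [ha])
  have h2 : (v a - v b) ^ 2 / dist a.1 b.1 ≤ 2 * G.edgeEnergy v a := by
    unfold edgeEnergy
    have := Finset.single_le_sum (f := fun y : G.nodes => (v a - v y) ^ 2 / dist a.1 y.1)
      (s := Finset.univ.filter fun y => G.graph.Adj a y)
      (fun y _ => div_nonneg (sq_nonneg _) dist_nonneg) (by simpa using hab)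
    linarith
  rw [div_le_iff₀ (dist_pos_of_adj hab)] at h2
  have h3 := h.locality a b hab
  have h4 := G.Lsq_nonneg ω v
  calc _ ≤ 2 * G.edgeEnergy v a * dist a.1 b.1 := h2
    _ ≤ 2 * G.Lsq ω v * R₀ := by gcongr
    _ = _ := by ring

/-- On a box, a function differs from its value at any node of the connecting subgraph by at most
a multiple of the local energy: any two nodes are joined by a path with at most `#𝒩` edges. -/
theorem Msq_sub_le {R₀ σ ρ : ℝ} (h : G.NetworkAssumptions R₀ σ ρ) {R : ℝ} (hR : R₀ ≤ R)
    {x : Pt d} (S : G.graph.Subgraph) (hS : S.Connected)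
    (h1 : ∀ y z : G.nodes, G.graph.Adj y z → y.1 ∈ G.B R x → S.Adj y z)
    (h2 : ∀ y z : G.nodes, S.Adj y z → y.1 ∈ G.B (R + R₀) x ∧ z.1 ∈ G.B (R + R₀) x)
    (v : G.nodes → ℝ) {c : G.nodes} (hc : c ∈ S.verts) :
    G.Msq (G.B R x) (fun y => v y - v c) ≤
      (√((∑ y, G.weight y) * Fintype.card G.nodes ^ 2 * 2 / R₀) * R) ^ 2 *
        G.Lsq (G.B (R + R₀) x) v := by
  have hR₀ := h.R₀_pos
  set A : ℝ := (Fintype.card G.nodes : ℝ) with hA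
  set Λ := G.Lsq (G.B (R + R₀) x) v with hΛ
  have hΛ0 : 0 ≤ Λ := G.Lsq_nonneg _ _
  have hw : 0 ≤ ∑ y, G.weight y := Finset.sum_nonneg fun y _ => G.weight_nonneg y
  have key : ∀ y ∈ S.verts, (v y - v c) ^ 2 ≤ A ^ 2 * (2 * R₀ * Λ) := by
    intro y hy
    have h3 := abs_sub_le_of_connected (g := S.coe) hS.coe (f := fun a => v a.1)
      (Real.sqrt_nonneg (2 * R₀ * Λ)) (fun a b hab => by
        rw [← Real.sqrt_sq_eq_abs]
        exact Real.sqrt_le_sqrt (sq_sub_le_of_adj h v (S.adj_sub hab) (h2 _ _ hab).1))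
      ⟨y, hy⟩ ⟨c, hc⟩
    have h4 : (Fintype.card S.verts : ℝ) ≤ A := by
      exact Nat.cast_le.2 <| Fintype.card_le_of_injective (fun a : S.verts => a.1) Subtype.val_injective
    have h5 : |v y - v c| ≤ √(2 * R₀ * Λ) * A := h3.trans (by gcongr)
    calc (v y - v c) ^ 2 = |v y - v c| ^ 2 := (sq_abs _).symm
      _ ≤ (√(2 * R₀ * Λ) * A) ^ 2 := by gcongr
      _ = A ^ 2 * (2 * R₀ * Λ) := by
        rw [mul_pow, Real.sq_sqrt (by positivity)]
        ring
  have hx : ∀ y : G.nodes, y.1 ∈ G.B R x →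
      G.weight y * (v y - v c) ^ 2 ≤ G.weight y * (A ^ 2 * (2 * R₀ * Λ)) := by
    intro y hy
    by_cases hz : ∃ z, G.graph.Adj y z
    · obtain ⟨z, hz⟩ := hz
      exact mul_le_mul_of_nonneg_left (key y (h1 y z hz hy).fst_mem) (G.weight_nonneg y)
    · -- a node without edges has no mass
      have : G.weight y = 0 := by
        push Not at hz
        simp [weight, hz]
      simp [this]
  calc G.Msq (G.B R x) (fun y => v y - v c)
      ≤ ∑ y : G.nodes with y.1 ∈ G.B R x, G.weight y * (A ^ 2 * (2 * R₀ * Λ)) := by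
        rw [Msq_eq]
        exact Finset.sum_le_sum fun y hy => hx y (Finset.mem_filter.1 hy).2
    _ ≤ ∑ y, G.weight y * (A ^ 2 * (2 * R₀ * Λ)) :=
        Finset.sum_le_sum_of_subset_of_nonneg (Finset.filter_subset _ _) fun y _ _ =>
          mul_nonneg (G.weight_nonneg y) (by positivity)
    _ = (∑ y, G.weight y) * A ^ 2 * 2 / R₀ * R₀ ^ 2 * Λ := by
        rw [← Finset.sum_mul]
        field_simp
    _ ≤ (∑ y, G.weight y) * A ^ 2 * 2 / R₀ * R ^ 2 * Λ := by gcongr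
    _ = _ := by rw [mul_pow, Real.sq_sqrt (by positivity)]

theorem exists_isPoincareConstant {R₀ σ ρ : ℝ} (h : G.NetworkAssumptions R₀ σ ρ) :
    ∃ μ, G.IsPoincareConstant R₀ μ := by
  refine ⟨√((∑ y, G.weight y) * Fintype.card G.nodes ^ 2 * 2 / R₀), Real.sqrt_nonneg _, ?_, ?_⟩
  · rintro R hR x hx ⟨y, hyΓ, hy⟩ v hv
    obtain ⟨S, hS, h1, h2⟩ := h.connectivity R hR x hx
    by_cases hz : ∃ z, G.graph.Adj y z
    · obtain ⟨z, hz⟩ := hz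
      have := Msq_sub_le h hR S hS h1 h2 v (h1 y z hz hy).fst_mem
      rw [hv y hyΓ] at this
      simpa using this
    · -- a node without edges is the only node of the network
      have h0 : ∀ a : G.nodes, G.weight a = 0 := by
        intro a
        obtain rfl : a = y := by
          by_contra hne
          obtain ⟨p⟩ := G.connected.preconnected y a
          cases p with
          | nil => exact hne rfl
          | cons hab _ => exact hz ⟨_, hab⟩
        push Not at hz
        simp [weight, hz]
      have : G.Msq (G.B R x) v = 0 := by simp [Msq_eq, h0]
      rw [this]
      exact mul_nonneg (sq_nonneg _) (G.Lsq_nonneg _ _)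
  · intro R hR x hx v
    obtain ⟨S, hS, h1, h2⟩ := h.connectivity R hR x hx
    obtain ⟨c, hc⟩ := hS.nonempty
    exact ⟨v c, Msq_sub_le h hR S hS h1 h2 v hc⟩

/-! ### Overlap and mass bounds -/

section Mesh

variable {R₀ σ ρ μ H : ℝ} {N : Fin d → ℕ}

theorem IsMesh.N_pos (hm : G.IsMesh H N) (i : Fin d) : 0 < N i := by
  have h1 := G.side_pos i
  rw [hm.side_eq i] at h1
  rcases Nat.eq_zero_or_pos (N i) with h | h
  · simp [h] at h1
  · exact h

theorem IsMesh.sum_nodal (hm : G.IsMesh H N) (x : G.nodes) :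
    ∑ k : (i : Fin d) → Fin (N i + 1), nodal H k x.1 = 1 := by
  have hs : G.side = fun i => N i * H := funext hm.side_eq
  exact _root_.sum_nodal hm.H_pos (hs ▸ G.nodes_subset x.1 x.2)

/-- Sums of a nonnegative function over neighbourhoods of the mesh nodes have finite overlap. -/
theorem sum_sum_near_le (g : G.nodes → ℝ) (hg : ∀ x, 0 ≤ g x)
    (P : ((i : Fin d) → Fin (N i + 1)) → G.nodes → Prop)
    (hP : ∀ k x, P k x → ∀ i, |x.1 i / H - ((k i : ℕ) : ℝ)| ≤ 7) :
    ∑ k, ∑ x with P k x, g x ≤ 15 ^ d * ∑ x, g x := by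
  rw [Finset.sum_comm' (t' := Finset.univ) (s' := fun x => Finset.univ.filter fun k => P k x)
    (by simp), Finset.mul_sum]
  refine Finset.sum_le_sum fun x _ => ?_
  rw [Finset.sum_const, nsmul_eq_mul]
  exact mul_le_mul_of_nonneg_right
    (card_near_le _ (fun i => x.1 i / H) (fun k => P k x) fun k hk => hP k x hk) (hg x)

theorem mass_cell (h : G.NetworkAssumptions R₀ σ ρ) (hm : G.IsMesh H N) (hR : 2 * R₀ ≤ H)
    (k : (i : Fin d) → Fin (N i)) :
    ρ * H ^ d ≤ ∑ x : G.nodes with x.1 ∈ cell G.side H k, G.weight x ∧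
      ∑ x : G.nodes with x.1 ∈ cell G.side H k, G.weight x ≤ σ * ρ * H ^ d := by
  have hH := hm.H_pos
  have h1 := h.homogeneity (H / 2) (by linarith) (cellCentre H k)
    (cellCentre_mem_centres hH hm.side_eq k).1 (cell_subset_rect hH hm.side_eq k)
  rw [Msq_one, show 2 * (H / 2) = H by ring] at h1
  have hp : 0 < H ^ d := by positivity
  rw [← div_eq_inv_mul, le_div_iff₀ hp, div_le_iff₀ hp] at h1
  exact h1

theorem one_le_sigma (h : G.NetworkAssumptions R₀ σ ρ) (hm : G.IsMesh H N) (hR : 2 * R₀ ≤ H) :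
    1 ≤ σ := by
  obtain ⟨h1, h2⟩ := mass_cell h hm hR fun i => ⟨0, hm.N_pos i⟩
  have hp : 0 < ρ * H ^ d := mul_pos h.ρ_pos (pow_pos hm.H_pos d)
  have h3 : 1 * (ρ * H ^ d) ≤ σ * (ρ * H ^ d) := by linarith
  exact le_of_mul_le_mul_right h3 hp

theorem mass_near_le (h : G.NetworkAssumptions R₀ σ ρ) (hm : G.IsMesh H N) (hR : 2 * R₀ ≤ H)
    (k : (i : Fin d) → Fin (N i + 1)) (P : G.nodes → Prop) [DecidablePred P]
    (hP : ∀ x, P x → ∀ i, |x.1 i / H - ((k i : ℕ) : ℝ)| ≤ 6) :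
    ∑ x with P x, G.weight x ≤ 15 ^ d * (σ * ρ * H ^ d) := by
  have hH := hm.H_pos
  set S : Finset ((i : Fin d) → Fin (N i)) :=
    Finset.univ.filter fun k' => ∀ i, |((k i : ℕ) : ℝ) - ((k' i : ℕ) : ℝ)| ≤ 7
  calc ∑ x with P x, G.weight x
      ≤ ∑ x with P x, ∑ k' ∈ S with x.1 ∈ cell G.side H k', G.weight x := by
        refine Finset.sum_le_sum fun x hx => ?_
        obtain ⟨k', hk'⟩ := exists_mem_cell hH hm.N_pos hm.side_eq (G.nodes_subset x.1 x.2)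
        refine Finset.single_le_sum (f := fun _ => G.weight x) (fun _ _ => G.weight_nonneg x)
          (Finset.mem_filter.2 ⟨Finset.mem_filter.2 ⟨Finset.mem_univ k', fun i => ?_⟩, hk'⟩)
        have h1 := abs_le.1 (hP x (Finset.mem_filter.1 hx).2 i)
        obtain ⟨h2, h3⟩ := bounds_of_mem_cell hk' i
        rw [← le_div_iff₀ hH] at h2
        rw [← div_le_iff₀ hH] at h3
        exact abs_le.2 ⟨by linarith, by linarith⟩
    _ ≤ ∑ x, ∑ k' ∈ S with x.1 ∈ cell G.side H k', G.weight x :=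
        Finset.sum_le_sum_of_subset_of_nonneg (Finset.filter_subset _ _) fun x _ _ =>
          Finset.sum_nonneg fun _ _ => G.weight_nonneg x
    _ = ∑ k' ∈ S, ∑ x : G.nodes with x.1 ∈ cell G.side H k', G.weight x :=
        Finset.sum_comm' (by simp [and_comm])
    _ ≤ ∑ k' ∈ S, σ * ρ * H ^ d := Finset.sum_le_sum fun k' _ => (mass_cell h hm hR k').2
    _ = S.card * (σ * ρ * H ^ d) := by rw [Finset.sum_const, nsmul_eq_mul]
    _ ≤ 15 ^ d * (σ * ρ * H ^ d) := by
        refine mul_le_mul_of_nonneg_right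
          (card_near_le _ (fun i => ((k i : ℕ) : ℝ)) _ fun k' hk' => hk') ?_
        have := one_le_sigma h hm hR
        have := h.ρ_pos
        positivity

/-! ### Lower bound for the Poincaré constant -/

theorem near_of_mem_box (hH : 0 < H) {R r : ℝ} (hr : R ≤ r * H)
    {k : (i : Fin d) → Fin (N i + 1)} {z : Pt d} (hz : z ∈ G.B R (meshNode H k)) (i : Fin d) :
    |z i / H - ((k i : ℕ) : ℝ)| ≤ r := by
  have h1 := (abs_sub_le_of_mem_box hz i).trans hr
  have h8 : meshNode H k i = ((k i : ℕ) : ℝ) * H := rfl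
  rw [show z i / H - ((k i : ℕ) : ℝ) = (z i - ((k i : ℕ) : ℝ) * H) / H by field_simp, abs_div,
    abs_of_pos hH, div_le_iff₀ hH, ← h8]
  exact h1

theorem mem_box_of_near (hH : 0 < H) {r : ℝ}
    {k : (i : Fin d) → Fin (N i + 1)} {z : Pt d}
    (hz : ∀ i, |z i / H - ((k i : ℕ) : ℝ)| < r) : z ∈ G.B (r * H) (meshNode H k) := by
  refine mem_box_of_abs_lt fun i => ?_
  have h8 : meshNode H k i = ((k i : ℕ) : ℝ) * H := rfl
  have := hz i
  rwa [show z i / H - ((k i : ℕ) : ℝ) = (z i - ((k i : ℕ) : ℝ) * H) / H by field_simp, abs_div,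
    abs_of_pos hH, div_lt_iff₀ hH, ← h8] at this

theorem Msq_ge_of_cell (h : G.NetworkAssumptions R₀ σ ρ) (hm : G.IsMesh H N) (hR : 2 * R₀ ≤ H)
    (k : (i : Fin d) → Fin (N i)) {ω : Set (Pt d)} (hω : cell G.side H k ⊆ ω)
    (v : G.nodes → ℝ) {a : ℝ} (ha : 0 ≤ a)
    (hv : ∀ x : G.nodes, x.1 ∈ cell G.side H k → a ≤ v x ^ 2) :
    a * (ρ * H ^ d) ≤ G.Msq ω v := by
  rw [Msq_eq]
  calc a * (ρ * H ^ d) ≤ a * ∑ x : G.nodes with x.1 ∈ cell G.side H k, G.weight x := by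
        gcongr
        exact (mass_cell h hm hR k).1
    _ ≤ ∑ x : G.nodes with x.1 ∈ cell G.side H k, G.weight x * v x ^ 2 := by
        rw [Finset.mul_sum]
        refine Finset.sum_le_sum fun x hx => ?_
        rw [mul_comm]
        exact mul_le_mul_of_nonneg_left (hv x (Finset.mem_filter.1 hx).2) (G.weight_nonneg x)
    _ ≤ _ := by
        refine Finset.sum_le_sum_of_subset_of_nonneg (fun x hx => ?_) fun x _ _ =>
          mul_nonneg (G.weight_nonneg x) (sq_nonneg _)
        simp only [Finset.mem_filter, Finset.mem_univ, true_and] at hx ⊢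
        exact hω hx

/-- If the mesh has three elements in direction `i`, the Poincaré inequality for the coordinate
function `z ↦ z_i` bounds `σ μ²` from below: no constant is close to this function on both the
first and the third element, while its energy is at most the mass. -/
theorem one_le_of_three_le (h : G.NetworkAssumptions R₀ σ ρ) (hm : G.IsMesh H N)
    (hR : 2 * R₀ ≤ H) (hμ : G.IsPoincareConstant R₀ μ) {i : Fin d} (hi : 3 ≤ N i) :
    1 ≤ 100 * 15 ^ d * (σ * μ ^ 2) := by
  have hH := hm.H_pos
  have hR₀ := h.R₀_pos
  have hp : 0 < ρ * H ^ d := mul_pos h.ρ_pos (pow_pos hH d)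
  let k0 : (i : Fin d) → Fin (N i + 1) := fun _ => 0
  obtain ⟨c, hc⟩ := hμ.poincare (5 * H) (by linarith) (meshNode H k0)
    (meshNode_mem_rect hH hm.side_eq k0) fun x => x.1 i
  -- the upper bound for the energy
  have hL : G.Lsq (G.B (5 * H + R₀) (meshNode H k0)) (fun x => x.1 i) ≤
      15 ^ d * (σ * ρ * H ^ d) := by
    rw [Lsq_eq]
    refine (Finset.sum_le_sum fun x _ => ?_).trans (mass_near_le h hm hR k0 _ fun x hx =>
      near_of_mem_box hH (by linarith) hx)
    have h1 := edgeEnergy_le (G := G) (fun x => x.1 i) 0 x 0 1 fun y _ => by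
      have h2 := PiLp.norm_apply_le (x.1 - y.1) i
      rw [← dist_eq_norm] at h2
      rw [zero_mul, zero_add, one_mul, ← sq_abs (x.1 i - y.1 i)]
      exact pow_le_pow_left₀ (abs_nonneg _) h2 2
    linarith
  -- the lower bound for the distance to constants
  have hM : (H / 2) ^ 2 * (ρ * H ^ d) ≤
      G.Msq (G.B (5 * H) (meshNode H k0)) (fun x => x.1 i - c) := by
    rcases le_total c (3 / 2 * H) with hc' | hc'
    · let k : (j : Fin d) → Fin (N j) := fun j =>
        ⟨if j = i then 2 else 0, by
          split_ifs with hj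
          · subst hj
            omega
          · exact hm.N_pos j⟩
      refine Msq_ge_of_cell h hm hR k (fun z hz => mem_box_of_near hH fun j => ?_) _
        (by positivity) fun x hx => ?_
      · obtain ⟨h1, h2⟩ := bounds_of_mem_cell hz j
        rw [← le_div_iff₀ hH] at h1
        rw [← div_le_iff₀ hH] at h2
        have h3 : ((k j : ℕ) : ℝ) ≤ 2 := by
          have : (k j : ℕ) ≤ 2 := by
            change (if j = i then 2 else 0) ≤ 2
            split_ifs <;> omega
          exact_mod_cast this
        have h4 : (0 : ℝ) ≤ ((k j : ℕ) : ℝ) := Nat.cast_nonneg _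
        have h5 : ((k0 j : ℕ) : ℝ) = 0 := by simp [k0]
        rw [h5, abs_lt]
        constructor <;> linarith
      · have h1 := (bounds_of_mem_cell hx i).1
        have h2 : ((k i : ℕ) : ℝ) = 2 := by simp [k]
        rw [h2] at h1
        exact pow_le_pow_left₀ (by positivity) (by linarith) 2
    · let k : (j : Fin d) → Fin (N j) := fun j => ⟨0, hm.N_pos j⟩
      have h2 : ∀ j, ((k j : ℕ) : ℝ) = 0 := fun j => by simp [k]
      refine Msq_ge_of_cell h hm hR k (fun z hz => mem_box_of_near hH fun j => ?_) _
        (by positivity) fun x hx => ?_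
      · obtain ⟨h1, h3⟩ := bounds_of_mem_cell hz j
        rw [h2, ← le_div_iff₀ hH] at h1
        rw [h2, ← div_le_iff₀ hH] at h3
        have h5 : ((k0 j : ℕ) : ℝ) = 0 := by simp [k0]
        rw [h5, abs_lt]
        constructor <;> linarith
      · have h1 := (bounds_of_mem_cell hx i).2
        rw [h2] at h1
        rw [← neg_sq (x.1 i - c)]
        exact pow_le_pow_left₀ (by positivity) (by linarith) 2
  have h1 : (H / 2) ^ 2 * (ρ * H ^ d) ≤ (μ * (5 * H)) ^ 2 * (15 ^ d * (σ * ρ * H ^ d)) :=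
    hM.trans (hc.trans (mul_le_mul_of_nonneg_left hL (sq_nonneg _)))
  have h2 : 1 * (H ^ 2 / 4 * (ρ * H ^ d)) ≤
      100 * 15 ^ d * (σ * μ ^ 2) * (H ^ 2 / 4 * (ρ * H ^ d)) := by
    refine (le_of_eq ?_).trans (h1.trans_eq ?_) <;> ring
  exact le_of_mul_le_mul_right h2 (by positivity)

theorem one_le_of_three_le_or (h : G.NetworkAssumptions R₀ σ ρ) (hm : G.IsMesh H N)
    (hR : 2 * R₀ ≤ H) (hμ : G.IsPoincareConstant R₀ μ) (hN : (∃ i, 3 ≤ N i) ∨ 1 ≤ μ) :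
    1 ≤ 100 * 15 ^ d * (σ * μ ^ 2) := by
  rcases hN with ⟨i, hi⟩ | hN
  · exact one_le_of_three_le h hm hR hμ hi
  · have h1 : (1 : ℝ) ≤ 15 ^ d := one_le_pow₀ (by norm_num)
    have h2 := one_le_sigma h hm hR
    have h3 : 1 ≤ μ ^ 2 := one_le_pow₀ hN
    have h4 : 1 ≤ σ * μ ^ 2 := one_le_mul_of_one_le_of_one_le h2 h3
    nlinarith

/-! ### The quasi-interpolant -/

theorem sum_near_le (t : Fin d → ℝ) (f : ((i : Fin d) → Fin (N i + 1)) → ℝ) {b : ℝ} (hb : 0 ≤ b)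
    (hf : ∀ k, f k ≤ b) (hn : ∀ k, f k ≠ 0 → ∀ i, |t i - ((k i : ℕ) : ℝ)| ≤ 7) :
    ∑ k, f k ≤ 15 ^ d * b := by
  rw [← Finset.sum_filter_ne_zero]
  refine (Finset.sum_le_sum fun k _ => hf k).trans ?_
  rw [Finset.sum_const, nsmul_eq_mul]
  exact mul_le_mul_of_nonneg_right (card_near_le _ t _ hn) hb

theorem sq_sum_near_le (t : Fin d → ℝ) (f : ((i : Fin d) → Fin (N i + 1)) → ℝ)
    (hn : ∀ k, f k ≠ 0 → ∀ i, |t i - ((k i : ℕ) : ℝ)| ≤ 7) :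
    (∑ k, f k) ^ 2 ≤ 15 ^ d * ∑ k, f k ^ 2 := by
  rw [← Finset.sum_filter_ne_zero]
  refine sq_sum_le_card_mul_sum_sq.trans ?_
  refine mul_le_mul (card_near_le _ t _ hn) ?_ (Finset.sum_nonneg fun _ _ => sq_nonneg _)
    (by positivity)
  exact Finset.sum_le_sum_of_subset_of_nonneg (Finset.subset_univ _) fun _ _ _ => sq_nonneg _

theorem near_of_adj (h : G.NetworkAssumptions R₀ σ ρ) (hH : 0 < H) (hR : 2 * R₀ ≤ H)
    {x y : G.nodes} (hxy : G.graph.Adj x y) (i : Fin d) : |x.1 i / H - y.1 i / H| ≤ 1 := by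
  have h1 := PiLp.norm_apply_le (x.1 - y.1) i
  rw [← dist_eq_norm] at h1
  have h2 := h.locality x y hxy
  have h3 := h.R₀_pos
  have h4 : |x.1 i - y.1 i| ≤ dist x.1 y.1 := h1
  rw [← sub_div, abs_div, abs_of_pos hH, div_le_one hH]
  linarith

theorem near_trans {a b k r s : ℝ} (h1 : |a - b| ≤ r) (h2 : |b - k| ≤ s) : |a - k| ≤ r + s :=
  (abs_sub_le a b k).trans (add_le_add h1 h2)

/-- Good local constants: the constant of a mesh node is `0` on `Γ`, where the Friedrichs
inequality applies, and otherwise comes from the Poincaré inequality. -/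
theorem exists_local_constants (h : G.NetworkAssumptions R₀ σ ρ) (hm : G.IsMesh H N)
    (hR : 2 * R₀ ≤ H) (hμ : G.IsPoincareConstant R₀ μ) {v : G.nodes → ℝ} (hv : v ∈ G.V) :
    ∃ c : ((i : Fin d) → Fin (N i + 1)) → ℝ, (∀ k, meshNode H k ∈ G.Γ → c k = 0) ∧
      ∀ k, G.Msq (G.B (5 * H) (meshNode H k)) (fun x => v x - c k) ≤
        (μ * (5 * H)) ^ 2 * G.Lsq (G.B (5 * H + R₀) (meshNode H k)) v := by
  have hH := hm.H_pos
  have key : ∀ k : (i : Fin d) → Fin (N i + 1), ∃ c : ℝ, (meshNode H k ∈ G.Γ → c = 0) ∧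
      G.Msq (G.B (5 * H) (meshNode H k)) (fun x => v x - c) ≤
        (μ * (5 * H)) ^ 2 * G.Lsq (G.B (5 * H + R₀) (meshNode H k)) v := by
    intro k
    have hk := meshNode_mem_rect hH hm.side_eq k
    by_cases hΓ : meshNode H k ∈ G.Γ
    · refine ⟨0, fun _ => rfl, ?_⟩
      simp only [sub_zero]
      obtain ⟨x, hx, hxk⟩ := h.boundary_density _ hΓ
      refine hμ.friedrichs (5 * H) (by linarith) _ hk ⟨x, hx, mem_box_of_abs_lt fun i => ?_⟩ v hv
      have h1 := PiLp.norm_apply_le (x.1 - meshNode H k) i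
      rw [← dist_eq_norm] at h1
      have h4 : |x.1 i - meshNode H k i| ≤ dist x.1 (meshNode H k) := h1
      linarith
    · obtain ⟨c, hc⟩ := hμ.poincare (5 * H) (by linarith) _ hk v
      exact ⟨c, fun hΓ' => absurd hΓ' hΓ, hc⟩
  choose c hc using key
  exact ⟨c, fun k => (hc k).1, fun k => (hc k).2⟩

theorem sum_local_energy_le (hH : 0 < H) (hR : 2 * R₀ ≤ H) (v : G.nodes → ℝ) :
    ∑ k : (i : Fin d) → Fin (N i + 1), G.Lsq (G.B (5 * H + R₀) (meshNode H k)) v ≤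
      15 ^ d * G.Lsq G.Ω v := by
  rw [Lsq_domain]
  exact sum_sum_near_le _ (G.edgeEnergy_nonneg v) _ fun k x hx =>
    near_of_mem_box hH (by linarith) hx

/-- The local constants of neighbouring mesh nodes are close to each other, because both are
close to `v` on an element that belongs to both boxes. -/
theorem sq_sub_local_constants_le (h : G.NetworkAssumptions R₀ σ ρ) (hm : G.IsMesh H N)
    (hR : 2 * R₀ ≤ H) {v : G.nodes → ℝ} {c : ((i : Fin d) → Fin (N i + 1)) → ℝ}
    (hc : ∀ k, G.Msq (G.B (5 * H) (meshNode H k)) (fun x => v x - c k) ≤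
      (μ * (5 * H)) ^ 2 * G.Lsq (G.B (5 * H + R₀) (meshNode H k)) v)
    (k k' : (i : Fin d) → Fin (N i + 1))
    (hk : ∀ i, |((k i : ℕ) : ℝ) - ((k' i : ℕ) : ℝ)| ≤ 3) :
    (c k - c k') ^ 2 * (ρ * H ^ d) ≤ 50 * μ ^ 2 * H ^ 2 *
      (G.Lsq (G.B (5 * H + R₀) (meshNode H k)) v +
        G.Lsq (G.B (5 * H + R₀) (meshNode H k')) v) := by
  have hH := hm.H_pos
  let m : (i : Fin d) → Fin (N i) := fun i =>
    ⟨min (k i : ℕ) (N i - 1), by have := hm.N_pos i; omega⟩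
  have hmk : ∀ z ∈ cell G.side H m, ∀ i, |z i / H - ((k i : ℕ) : ℝ)| ≤ 1 := by
    intro z hz i
    obtain ⟨h1, h2⟩ := bounds_of_mem_cell hz i
    rw [← le_div_iff₀ hH] at h1
    rw [← div_le_iff₀ hH] at h2
    have h3 : (m i : ℕ) ≤ (k i : ℕ) := min_le_left _ _
    have h4 : (k i : ℕ) ≤ (m i : ℕ) + 1 := by
      have h5 := (k i).2
      change (k i : ℕ) ≤ min (k i : ℕ) (N i - 1) + 1
      omega
    have h3' : ((m i : ℕ) : ℝ) ≤ ((k i : ℕ) : ℝ) := by exact_mod_cast h3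
    have h4' : ((k i : ℕ) : ℝ) ≤ ((m i : ℕ) : ℝ) + 1 := by exact_mod_cast h4
    exact abs_le.2 ⟨by linarith, by linarith⟩
  have hsub : ∀ a, (∀ z ∈ cell G.side H m, z ∈ G.B (5 * H) (meshNode H a)) →
      ∑ x : G.nodes with x.1 ∈ cell G.side H m, G.weight x * (v x - c a) ^ 2 ≤
        (μ * (5 * H)) ^ 2 * G.Lsq (G.B (5 * H + R₀) (meshNode H a)) v := by
    intro a ha
    refine le_trans ?_ (hc a)
    rw [Msq_eq]
    refine Finset.sum_le_sum_of_subset_of_nonneg (fun x hx => ?_) fun x _ _ =>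
      mul_nonneg (G.weight_nonneg x) (sq_nonneg _)
    simp only [Finset.mem_filter, Finset.mem_univ, true_and] at hx ⊢
    exact ha _ hx
  have h1 := hsub k fun z hz => mem_box_of_near hH fun i => (hmk z hz i).trans_lt (by norm_num)
  have h2 := hsub k' fun z hz => mem_box_of_near hH fun i =>
    (near_trans (hmk z hz i) (hk i)).trans_lt (by norm_num)
  calc (c k - c k') ^ 2 * (ρ * H ^ d)
      ≤ (c k - c k') ^ 2 * ∑ x : G.nodes with x.1 ∈ cell G.side H m, G.weight x := by
        gcongr
        exact (mass_cell h hm hR m).1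
    _ ≤ 2 * ∑ x : G.nodes with x.1 ∈ cell G.side H m, G.weight x * (v x - c k) ^ 2 +
        2 * ∑ x : G.nodes with x.1 ∈ cell G.side H m, G.weight x * (v x - c k') ^ 2 := by
        rw [Finset.mul_sum, Finset.mul_sum, Finset.mul_sum, ← Finset.sum_add_distrib]
        refine Finset.sum_le_sum fun x _ => ?_
        have h3 : (c k - c k') ^ 2 ≤ 2 * (v x - c k) ^ 2 + 2 * (v x - c k') ^ 2 := by
          nlinarith [sq_nonneg (v x - c k + (v x - c k'))]
        nlinarith [G.weight_nonneg x]
    _ ≤ _ := by linarith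

/-- Stability of the quasi-interpolant `∑ c_k φ_k`: along an edge only the differences of nearby
constants `c_k` matter, and the density upper bound turns the energies of the `φ_k` into mass. -/
theorem Lsq_interp_le (h : G.NetworkAssumptions R₀ σ ρ) (hm : G.IsMesh H N)
    (hR : 2 * R₀ ≤ H) {v : G.nodes → ℝ} {c : ((i : Fin d) → Fin (N i + 1)) → ℝ}
    (hc : ∀ k, G.Msq (G.B (5 * H) (meshNode H k)) (fun x => v x - c k) ≤
      (μ * (5 * H)) ^ 2 * G.Lsq (G.B (5 * H + R₀) (meshNode H k)) v) :
    G.Lsq G.Ω (fun x => ∑ k, c k * nodal H k x.1) ≤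
      50 * d ^ 2 * (15 ^ d) ^ 3 * (1 + 15 ^ d) * (σ * μ ^ 2) * G.Lsq G.Ω v := by
  have hH := hm.H_pos
  have hp : 0 < ρ * H ^ d := mul_pos h.ρ_pos (pow_pos hH d)
  have hσ := one_le_sigma h hm hR
  set A : ℝ := 15 ^ d with hA
  have hA0 : 0 < A := by positivity
  set ℓ : ((i : Fin d) → Fin (N i + 1)) → ℝ := fun k =>
    G.Lsq (G.B (5 * H + R₀) (meshNode H k)) v
  have hℓ : ∀ k, 0 ≤ ℓ k := fun k => G.Lsq_nonneg _ _
  set P : ((i : Fin d) → Fin (N i + 1)) → G.nodes → Prop := fun k x =>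
    ∀ i, |x.1 i / H - ((k i : ℕ) : ℝ)| ≤ 2
  set Q : ℝ := 50 * μ ^ 2 * H ^ 2 / (ρ * H ^ d)
  have hQ : 0 ≤ Q := by positivity
  set B : ℝ := A * (1 + A) * Q * (d / H) ^ 2 with hB
  have hB0 : 0 ≤ B := by positivity
  have hedge : ∀ x y : G.nodes, G.graph.Adj x y →
      (∑ k, c k * nodal H k x.1 - ∑ k, c k * nodal H k y.1) ^ 2 ≤
        B * (∑ k with P k x, ℓ k) * dist x.1 y.1 ^ 2 := by
    intro x y hxy
    obtain ⟨m, hmx⟩ := exists_mem_cell hH hm.N_pos hm.side_eq (G.nodes_subset x.1 x.2)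
    set k0 : (i : Fin d) → Fin (N i + 1) := fun i => (m i).castSucc
    have hk0 : ∀ i, |x.1 i / H - ((k0 i : ℕ) : ℝ)| ≤ 1 := by
      intro i
      obtain ⟨h1, h2⟩ := bounds_of_mem_cell hmx i
      rw [← le_div_iff₀ hH] at h1
      rw [← div_le_iff₀ hH] at h2
      have h3 : ((k0 i : ℕ) : ℝ) = ((m i : ℕ) : ℝ) := rfl
      rw [h3]
      exact abs_le.2 ⟨by linarith, by linarith⟩
    have hPk0 : P k0 x := fun i => (hk0 i).trans (by norm_num)
    -- constants may be subtracted since the nodal functions sum to one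
    have hdiff : ∑ k, c k * nodal H k x.1 - ∑ k, c k * nodal H k y.1 =
        ∑ k, (c k - c k0) * (nodal H k x.1 - nodal H k y.1) := by
      have h1 : ∀ z : G.nodes, ∑ k, (c k - c k0) * nodal H k z.1 =
          ∑ k, c k * nodal H k z.1 - c k0 := by
        intro z
        simp only [sub_mul]
        rw [Finset.sum_sub_distrib, ← Finset.mul_sum, hm.sum_nodal z, mul_one]
      simp only [mul_sub]
      rw [Finset.sum_sub_distrib, h1, h1]
      ring
    have hnear : ∀ k, (c k - c k0) * (nodal H k x.1 - nodal H k y.1) ≠ 0 → P k x := by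
      intro k hk i
      have h1 : nodal H k x.1 ≠ 0 ∨ nodal H k y.1 ≠ 0 := by
        by_contra! h0
        simp [h0.1, h0.2] at hk
      rcases h1 with h1 | h1
      · exact (abs_lt_one_of_nodal_ne_zero h1 i).le.trans (by norm_num)
      · exact (near_trans (near_of_adj h hH hR hxy i)
          (abs_lt_one_of_nodal_ne_zero h1 i).le).trans (by norm_num)
    have hterm : ∀ k, ((c k - c k0) * (nodal H k x.1 - nodal H k y.1)) ^ 2 ≤
        if P k x then Q * (ℓ k + ℓ k0) * ((d / H) ^ 2 * dist x.1 y.1 ^ 2) else 0 := by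
      intro k
      split_ifs with hP
      · rw [mul_pow]
        refine mul_le_mul ?_ ?_ (sq_nonneg _) (mul_nonneg hQ (add_nonneg (hℓ _) (hℓ _)))
        · have := sq_sub_local_constants_le h hm hR hc k k0 fun i => by
            rw [abs_sub_comm]
            refine (near_trans (s := 2) ?_ (hP i)).trans (by norm_num : (1 : ℝ) + 2 ≤ 3)
            rw [abs_sub_comm]
            exact hk0 i
          rw [← le_div_iff₀ hp] at this
          refine this.trans_eq ?_
          ring
        · rw [← mul_pow, ← sq_abs]
          refine pow_le_pow_left₀ (abs_nonneg _) ((abs_nodal_sub_le k hH x.1 y.1).trans_eq ?_) 2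
          ring
      · have : (c k - c k0) * (nodal H k x.1 - nodal H k y.1) = 0 := by
          by_contra h0
          exact hP (hnear k h0)
        simp [this]
    rw [hdiff]
    refine (sq_sum_near_le (fun i => x.1 i / H) _ fun k hk i =>
      (hnear k hk i).trans (by norm_num)).trans ?_
    have hcard : ∑ k with P k x, ℓ k0 ≤ A * ∑ k with P k x, ℓ k := by
      rw [Finset.sum_const, nsmul_eq_mul]
      refine mul_le_mul (card_near_le _ (fun i => x.1 i / H) _ fun k hk i =>
        (hk i).trans (by norm_num)) ?_ (hℓ _) hA0.le
      exact Finset.single_le_sum (f := ℓ) (fun k _ => hℓ k) (by simpa using hPk0)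
    calc A * ∑ k, ((c k - c k0) * (nodal H k x.1 - nodal H k y.1)) ^ 2
        ≤ A * ∑ k, if P k x then Q * (ℓ k + ℓ k0) * ((d / H) ^ 2 * dist x.1 y.1 ^ 2) else 0 := by
          gcongr
          exact hterm _
      _ = A * (Q * (∑ k with P k x, ℓ k + ∑ k with P k x, ℓ k0) *
            ((d / H) ^ 2 * dist x.1 y.1 ^ 2)) := by
          rw [← Finset.sum_filter, ← Finset.sum_mul, ← Finset.mul_sum, Finset.sum_add_distrib]
      _ ≤ A * (Q * (∑ k with P k x, ℓ k + A * ∑ k with P k x, ℓ k) *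
            ((d / H) ^ 2 * dist x.1 y.1 ^ 2)) := by gcongr
      _ = _ := by
          rw [hB]
          ring
  rw [Lsq_domain]
  calc ∑ x, G.edgeEnergy (fun x => ∑ k, c k * nodal H k x.1) x
      ≤ ∑ x, B * (∑ k with P k x, ℓ k) * G.weight x := by
        refine Finset.sum_le_sum fun x _ => ?_
        have := edgeEnergy_le (G := G) (fun x => ∑ k, c k * nodal H k x.1) 0 x 0
          (B * ∑ k with P k x, ℓ k) fun y hy => by
            rw [zero_mul, zero_add]
            exact hedge x y hy
        linarith
    _ = B * ∑ k, ℓ k * ∑ x with P k x, G.weight x := by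
        simp only [mul_assoc, ← Finset.mul_sum]
        congr 1
        simp only [Finset.sum_mul, Finset.mul_sum]
        exact Finset.sum_comm' (by simp)
    _ ≤ B * ∑ k, ℓ k * (A * (σ * ρ * H ^ d)) := by
        gcongr with k
        · exact hℓ k
        · exact mass_near_le h hm hR k (P k) fun x hx i => (hx i).trans (by norm_num)
    _ = B * (A * (σ * ρ * H ^ d)) * ∑ k, ℓ k := by
        rw [← Finset.sum_mul]
        ring
    _ ≤ B * (A * (σ * ρ * H ^ d)) * (A * G.Lsq G.Ω v) := by
        have := h.ρ_pos
        gcongr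
        exact sum_local_energy_le hH hR v
    _ = _ := by
        rw [hB]
        have h1 : Q * (ρ * H ^ d) = 50 * μ ^ 2 * H ^ 2 := div_mul_cancel₀ _ hp.ne'
        have h2 : (d / H : ℝ) ^ 2 * H ^ 2 = d ^ 2 := by field_simp
        calc _ = A ^ 3 * (1 + A) * (Q * (ρ * H ^ d)) * (d / H : ℝ) ^ 2 * σ * G.Lsq G.Ω v := by ring
          _ = A ^ 3 * (1 + A) * 50 * μ ^ 2 * ((d / H : ℝ) ^ 2 * H ^ 2) * σ * G.Lsq G.Ω v := by
            rw [h1]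
            ring
          _ = _ := by
            rw [h2]
            ring

/-- The error of the quasi-interpolant: at each node it is a convex combination of the differences
`v - c_k`, where only those `k` matter whose box contains the node. -/
theorem Msq_sub_interp_le (hm : G.IsMesh H N)
    (hR : 2 * R₀ ≤ H) {v : G.nodes → ℝ} {c : ((i : Fin d) → Fin (N i + 1)) → ℝ}
    (hc : ∀ k, G.Msq (G.B (5 * H) (meshNode H k)) (fun x => v x - c k) ≤
      (μ * (5 * H)) ^ 2 * G.Lsq (G.B (5 * H + R₀) (meshNode H k)) v) :
    ∑ x, G.weight x * (v x - ∑ k, c k * nodal H k x.1) ^ 2 ≤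
      25 * 15 ^ d * μ ^ 2 * H ^ 2 * G.Lsq G.Ω v := by
  have hH := hm.H_pos
  have hpt : ∀ x : G.nodes, (v x - ∑ k, c k * nodal H k x.1) ^ 2 ≤
      ∑ k with x.1 ∈ G.B (5 * H) (meshNode H k), (v x - c k) ^ 2 := by
    intro x
    have h1 : v x - ∑ k, c k * nodal H k x.1 = ∑ k, nodal H k x.1 * (v x - c k) := by
      simp only [mul_sub]
      rw [Finset.sum_sub_distrib, ← Finset.sum_mul, hm.sum_nodal x, one_mul]
      simp only [mul_comm]
    have h2 := Finset.sum_sq_le_sum_mul_sum_of_sq_le_mul Finset.univ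
      (f := fun k => nodal H k x.1) (g := fun k => nodal H k x.1 * (v x - c k) ^ 2)
      (r := fun k => nodal H k x.1 * (v x - c k)) (fun k _ => nodal_nonneg k _)
      (fun k _ => mul_nonneg (nodal_nonneg k _) (sq_nonneg _)) (fun k _ => le_of_eq (by ring))
    rw [hm.sum_nodal x, one_mul] at h2
    rw [h1, Finset.sum_filter]
    refine h2.trans (Finset.sum_le_sum fun k _ => ?_)
    split_ifs with hk
    · exact mul_le_of_le_one_left (sq_nonneg _) (nodal_le_one k _)
    · have : nodal H k x.1 = 0 := by
        by_contra h0
        exact hk (mem_box_of_near hH fun i =>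
          (abs_lt_one_of_nodal_ne_zero h0 i).trans (by norm_num))
      simp [this]
  calc ∑ x, G.weight x * (v x - ∑ k, c k * nodal H k x.1) ^ 2
      ≤ ∑ x, G.weight x * ∑ k with x.1 ∈ G.B (5 * H) (meshNode H k), (v x - c k) ^ 2 :=
        Finset.sum_le_sum fun x _ => mul_le_mul_of_nonneg_left (hpt x) (G.weight_nonneg x)
    _ = ∑ k, G.Msq (G.B (5 * H) (meshNode H k)) (fun x => v x - c k) := by
        simp only [Msq_eq, Finset.mul_sum]
        exact Finset.sum_comm' (by simp)
    _ ≤ ∑ k, (μ * (5 * H)) ^ 2 * G.Lsq (G.B (5 * H + R₀) (meshNode H k)) v :=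
        Finset.sum_le_sum fun k _ => hc k
    _ ≤ (μ * (5 * H)) ^ 2 * (15 ^ d * G.Lsq G.Ω v) := by
        rw [← Finset.mul_sum]
        gcongr
        exact sum_local_energy_le hH hR v
    _ = _ := by ring

/-! ### Localization by a partition of unity -/

theorem sum_Lsq_nodal_mul_le (h : G.NetworkAssumptions R₀ σ ρ) (hm : G.IsMesh H N)
    (hR : 2 * R₀ ≤ H) (e : G.nodes → ℝ) :
    ∑ k : (i : Fin d) → Fin (N i + 1), G.Lsq G.Ω (fun x => nodal H k x.1 * e x) ≤
      15 ^ d * (2 * G.Lsq G.Ω e + 2 * (d ^ 2 / H ^ 2) * ∑ x, G.weight x * e x ^ 2) := by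
  have hH := hm.H_pos
  have hedge : ∀ x y : G.nodes, G.graph.Adj x y → ∑ k : (i : Fin d) → Fin (N i + 1),
      (nodal H k x.1 * e x - nodal H k y.1 * e y) ^ 2 ≤
        15 ^ d * 2 * (e x - e y) ^ 2 +
          15 ^ d * (2 * (d ^ 2 / H ^ 2) * e x ^ 2) * dist x.1 y.1 ^ 2 := by
    intro x y hxy
    refine (sum_near_le (fun i => x.1 i / H) _
      (b := 2 * (e x - e y) ^ 2 + 2 * (d ^ 2 / H ^ 2) * e x ^ 2 * dist x.1 y.1 ^ 2)
      (by positivity) (fun k => ?_) fun k hk i => ?_).trans_eq (by ring)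
    · have h1 : (nodal H k x.1 - nodal H k y.1) ^ 2 ≤ d ^ 2 / H ^ 2 * dist x.1 y.1 ^ 2 := by
        rw [← sq_abs]
        refine (pow_le_pow_left₀ (abs_nonneg _) (abs_nodal_sub_le k hH x.1 y.1) 2).trans_eq ?_
        ring
      have h2 : nodal H k y.1 ^ 2 ≤ 1 := pow_le_one₀ (nodal_nonneg k _) (nodal_le_one k _)
      calc (nodal H k x.1 * e x - nodal H k y.1 * e y) ^ 2
          = (nodal H k y.1 * (e x - e y) + (nodal H k x.1 - nodal H k y.1) * e x) ^ 2 := by ring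
        _ ≤ 2 * (nodal H k y.1 ^ 2 * (e x - e y) ^ 2) +
            2 * ((nodal H k x.1 - nodal H k y.1) ^ 2 * e x ^ 2) := by
            nlinarith [sq_nonneg (nodal H k y.1 * (e x - e y) -
              (nodal H k x.1 - nodal H k y.1) * e x)]
        _ ≤ 2 * (1 * (e x - e y) ^ 2) + 2 * (d ^ 2 / H ^ 2 * dist x.1 y.1 ^ 2 * e x ^ 2) := by
            gcongr
        _ = _ := by ring
    · have h1 : nodal H k x.1 ≠ 0 ∨ nodal H k y.1 ≠ 0 := by
        by_contra! h0
        simp [h0.1, h0.2] at hk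
      rcases h1 with h1 | h1
      · exact (abs_lt_one_of_nodal_ne_zero h1 i).le.trans (by norm_num)
      · exact (near_trans (near_of_adj h hH hR hxy i)
          (abs_lt_one_of_nodal_ne_zero h1 i).le).trans (by norm_num)
  simp only [Lsq_domain]
  rw [Finset.sum_comm]
  refine (Finset.sum_le_sum fun x _ => sum_edgeEnergy_le Finset.univ
    (fun (k : (i : Fin d) → Fin (N i + 1)) x => nodal H k x.1 * e x) e x (15 ^ d * 2)
    (15 ^ d * (2 * (d ^ 2 / H ^ 2) * e x ^ 2)) (hedge x)).trans_eq ?_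
  rw [Finset.sum_add_distrib, ← Finset.mul_sum, mul_add, Finset.mul_sum, Finset.mul_sum,
    Finset.mul_sum, Finset.mul_sum, Finset.mul_sum]
  congr 1 <;> exact Finset.sum_congr rfl fun x _ => by ring

theorem interp_mem_VCoarse (hm : G.IsMesh H N) {c : ((i : Fin d) → Fin (N i + 1)) → ℝ}
    (hc : ∀ k, meshNode H k ∈ G.Γ → c k = 0) :
    (fun x : G.nodes => ∑ k, c k * nodal H k x.1) ∈ G.VCoarse H := by
  have h1 : (fun x : G.nodes => ∑ k, c k * nodal H k x.1) =
      ∑ k, c k • fun x : G.nodes => nodal H k x.1 := by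
    ext x
    simp
  rw [h1]
  refine Submodule.sum_mem _ fun k _ => ?_
  by_cases hk : meshNode H k ∈ G.Γ
  · rw [hc k hk, zero_smul]
    exact Submodule.zero_mem _
  · refine Submodule.smul_mem _ _ ⟨nodal H k, ?_, fun _ => rfl⟩
    obtain ⟨F, hF, hΓ⟩ := hm.aligned
    rw [hΓ] at hk ⊢
    exact isFEFunction_nodal hm.H_pos hF k hk

theorem VCoarse_le_V : G.VCoarse H ≤ G.V := by
  rintro v ⟨q, hq, hv⟩ x hx
  rw [hv x, hq.2.2 _ hx]

theorem Lsq_sub_le (u v : G.nodes → ℝ) :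
    G.Lsq G.Ω (fun x => u x - v x) ≤ 2 * G.Lsq G.Ω u + 2 * G.Lsq G.Ω v := by
  simp only [Lsq_domain, Finset.mul_sum]
  rw [← Finset.sum_add_distrib]
  refine Finset.sum_le_sum fun x _ => ?_
  unfold edgeEnergy
  simp only [Finset.mul_sum]
  rw [← Finset.sum_add_distrib]
  refine Finset.sum_le_sum fun y _ => ?_
  have h1 : (u x - v x - (u y - v y)) ^ 2 ≤ 2 * (u x - u y) ^ 2 + 2 * (v x - v y) ^ 2 := by
    nlinarith [sq_nonneg (u x - u y + (v x - v y))]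
  have h2 := div_le_div_of_nonneg_right h1 (dist_nonneg (x := x.1) (y := y.1))
  rw [add_div, mul_div_assoc, mul_div_assoc] at h2
  linarith

/-- A constant, depending only on the dimension, for the stability of the decomposition of a
scalar function with respect to the graph Laplacian. -/
noncomputable def stabilityConst (d : ℕ) : ℝ :=
  50 * d ^ 2 * (15 ^ d) ^ 3 * (1 + 15 ^ d) + 15 ^ d * (400 * 15 ^ d +
    4 * (50 * d ^ 2 * (15 ^ d) ^ 3 * (1 + 15 ^ d)) + 50 * d ^ 2 * 15 ^ d)

theorem exists_scalar_decomposition (h : G.NetworkAssumptions R₀ σ ρ) (hm : G.IsMesh H N)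
    (hR : 2 * R₀ ≤ H) (hμ : G.IsPoincareConstant R₀ μ) (hN : (∃ i, 3 ≤ N i) ∨ 1 ≤ μ)
    {v : G.nodes → ℝ} (hv : v ∈ G.V) :
    ∃ v₀ ∈ G.VCoarse H, ∃ w : ((i : Fin d) → Fin (N i + 1)) → G.nodes → ℝ,
      (∀ k, w k ∈ G.VOn (patch G.side H {meshNode H k})) ∧ v = v₀ + ∑ k, w k ∧
      G.Lsq G.Ω v₀ + ∑ k, G.Lsq G.Ω (w k) ≤
        stabilityConst d * (σ * μ ^ 2) * G.Lsq G.Ω v := by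
  have hH := hm.H_pos
  obtain ⟨c, hc0, hc⟩ := exists_local_constants h hm hR hμ hv
  set v₀ : G.nodes → ℝ := fun x => ∑ k, c k * nodal H k x.1 with hv₀
  have hcoarse : v₀ ∈ G.VCoarse H := interp_mem_VCoarse hm hc0
  refine ⟨v₀, hcoarse, fun k x => nodal H k x.1 * (v x - v₀ x), fun k => ⟨?_, ?_⟩, ?_, ?_⟩
  · intro x hx
    have h1 : v₀ x = 0 := VCoarse_le_V hcoarse x hx
    simp [h1, hv x hx]
  · intro x hx
    have h1 : nodal H k x.1 = 0 := by
      by_contra h0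
      exact hx (mem_patch_of_nodal_ne_zero hH hm.N_pos hm.side_eq (G.nodes_subset x.1 x.2) h0)
    simp [h1]
  · ext x
    rw [Pi.add_apply, Finset.sum_apply, ← Finset.sum_mul, hm.sum_nodal x]
    ring
  · have h1 := Lsq_interp_le h hm hR hc
    have h2 := Msq_sub_interp_le hm hR hc
    have h3 := sum_Lsq_nodal_mul_le h hm hR fun x => v x - v₀ x
    have h4 := Lsq_sub_le v v₀
    have h5 := one_le_of_three_le_or h hm hR hμ hN
    have hσ := one_le_sigma h hm hR
    have hL := G.Lsq_nonneg G.Ω v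
    rw [← hv₀] at h1
    set Λ := G.Lsq G.Ω v
    set A : ℝ := 15 ^ d
    set s := σ * μ ^ 2
    have hμs : μ ^ 2 ≤ s := le_mul_of_one_le_left (sq_nonneg _) hσ
    have hA0 : 0 < A := by positivity
    set C := 50 * (d : ℝ) ^ 2 * A ^ 3 * (1 + A) with hC
    have h6 : Λ ≤ 100 * A * s * Λ := le_mul_of_one_le_left hL h5
    have h7 : 2 * ((d : ℝ) ^ 2 / H ^ 2) * ∑ x, G.weight x * (v x - v₀ x) ^ 2 ≤
        50 * d ^ 2 * A * s * Λ := by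
      calc _ ≤ 2 * ((d : ℝ) ^ 2 / H ^ 2) * (25 * A * s * H ^ 2 * Λ) := by
            gcongr
            refine h2.trans ?_
            gcongr
        _ = _ := by
            field_simp
            ring
    have h8 : ∑ k : (i : Fin d) → Fin (N i + 1),
        G.Lsq G.Ω (fun x => nodal H k x.1 * (v x - v₀ x)) ≤
        A * ((400 * A + 4 * C + 50 * d ^ 2 * A) * s * Λ) := by
      refine h3.trans (mul_le_mul_of_nonneg_left ?_ hA0.le)
      linarith
    calc _ ≤ C * s * Λ + A * ((400 * A + 4 * C + 50 * d ^ 2 * A) * s * Λ) := add_le_add h1 h8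
      _ = _ := by
        rw [stabilityConst]
        ring

/-! ### Energy of a sum of local functions -/

theorem Lsq_add_sum_le (h : G.NetworkAssumptions R₀ σ ρ) (hm : G.IsMesh H N)
    (hR : 2 * R₀ ≤ H) (v₀ : G.nodes → ℝ) (w : ((i : Fin d) → Fin (N i + 1)) → G.nodes → ℝ)
    (hw : ∀ k, w k ∈ G.VOn (patch G.side H {meshNode H k})) :
    G.Lsq G.Ω (v₀ + ∑ k, w k) ≤ 2 * 15 ^ d * (G.Lsq G.Ω v₀ + ∑ k, G.Lsq G.Ω (w k)) := by
  have hH := hm.H_pos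
  have hA : (1 : ℝ) ≤ 15 ^ d := one_le_pow₀ (by norm_num)
  have hne : ∀ k x, w k x ≠ 0 → ∀ i, |x.1 i / H - ((k i : ℕ) : ℝ)| ≤ 1 := by
    intro k x hx
    refine abs_sub_le_of_mem_patch (l := G.side) hH ?_
    by_contra h0
    exact hx ((hw k).2 x h0)
  have hedge : ∀ x y : G.nodes, G.graph.Adj x y →
      ((v₀ + ∑ k, w k) x - (v₀ + ∑ k, w k) y) ^ 2 ≤
        2 * 15 ^ d * ((v₀ x - v₀ y) ^ 2 + ∑ k, (w k x - w k y) ^ 2) := by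
    intro x y hxy
    have h1 : (∑ k, (w k x - w k y)) ^ 2 ≤ 15 ^ d * ∑ k, (w k x - w k y) ^ 2 := by
      refine sq_sum_near_le (fun i => x.1 i / H) _ fun k hk i => ?_
      have h2 : w k x ≠ 0 ∨ w k y ≠ 0 := by
        by_contra! h0
        simp [h0.1, h0.2] at hk
      rcases h2 with h2 | h2
      · exact (hne k x h2 i).trans (by norm_num)
      · exact (near_trans (near_of_adj h hH hR hxy i) (hne k y h2 i)).trans (by norm_num)
    have h3 : (v₀ + ∑ k, w k) x - (v₀ + ∑ k, w k) y =
        (v₀ x - v₀ y) + ∑ k, (w k x - w k y) := by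
      simp only [Pi.add_apply, Finset.sum_apply, Finset.sum_sub_distrib]
      ring
    rw [h3]
    have h4 : (v₀ x - v₀ y) ^ 2 ≤ 15 ^ d * (v₀ x - v₀ y) ^ 2 :=
      le_mul_of_one_le_left (sq_nonneg _) hA
    nlinarith [sq_nonneg ((v₀ x - v₀ y) - ∑ k, (w k x - w k y))]
  simp only [Lsq_domain]
  rw [Finset.sum_comm, ← Finset.sum_add_distrib, Finset.mul_sum]
  refine Finset.sum_le_sum fun x _ => ?_
  unfold edgeEnergy
  rw [← Finset.mul_sum, Finset.sum_comm, ← mul_add, ← Finset.sum_add_distrib, mul_left_comm]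
  refine mul_le_mul_of_nonneg_left ?_ (by norm_num)
  rw [Finset.mul_sum]
  refine Finset.sum_le_sum fun y hy => ?_
  have hxy := (Finset.mem_filter.1 hy).2
  rw [← Finset.sum_div, ← add_div, ← mul_div_assoc]
  exact div_le_div_of_nonneg_right (hedge x y hxy) dist_nonneg

end Mesh

/-! ### Passage to the operator norm -/

section Operator

variable {n : ℕ} {K : (Fin n → G.nodes → ℝ) →ₗ[ℝ] (Fin n → G.nodes → ℝ)} {α β : ℝ}

theorem LsqVec_nonneg (v : Fin n → G.nodes → ℝ) : 0 ≤ G.LsqVec v :=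
  Finset.sum_nonneg fun _ _ => G.Lsq_nonneg _ _

theorem mem_vec {W : Submodule ℝ (G.nodes → ℝ)} {v : Fin n → G.nodes → ℝ} :
    v ∈ G.vec n W ↔ ∀ i, v i ∈ W := by
  simp [vec, Submodule.mem_pi]

theorem Ksq_le (hK : G.OperatorAssumptions K α β) {v : Fin n → G.nodes → ℝ}
    (hv : v ∈ G.vec n G.V) : G.Ksq K v ≤ max β 0 * G.LsqVec v :=
  (hK.bounded v hv).trans (mul_le_mul_of_nonneg_right (le_max_left _ _) (LsqVec_nonneg v))

/-- For negative `β` both sides vanish, since then `|v|_L = 0` on all of `V^n`. -/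
theorem max_mul_LsqVec_le (hK : G.OperatorAssumptions K α β) {v : Fin n → G.nodes → ℝ}
    (hv : v ∈ G.vec n G.V) : max β 0 * G.LsqVec v ≤ β * α⁻¹ * G.Ksq K v := by
  have hα := hK.alpha_pos
  have h1 := hK.coercive v hv
  have h2 := hK.bounded v hv
  have h3 := LsqVec_nonneg v
  change α * _ ≤ G.Ksq K v at h1
  change G.Ksq K v ≤ _ at h2
  rcases le_total 0 β with hβ | hβ
  · rw [max_eq_left hβ, mul_assoc]
    gcongr
    rwa [← div_eq_inv_mul, le_div_iff₀ hα, mul_comm]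
  · rw [max_eq_right hβ, zero_mul]
    have h4 : G.Ksq K v = 0 :=
      le_antisymm (h2.trans (mul_nonpos_of_nonpos_of_nonneg hβ h3)) (hK.posSemidef v)
    rw [h4, mul_zero]

end Operator

end SpatialNetwork

open SpatialNetwork in
theorem lemma4p1 (d : ℕ) :
    ∃ C : ℝ, 0 < C ∧
      ∀ (G : SpatialNetwork d) (R₀ σ ρ : ℝ), G.NetworkAssumptions R₀ σ ρ →
        (∃ μ : ℝ, G.IsPoincareConstant R₀ μ) ∧
        ∀ (H : ℝ) (N : Fin d → ℕ), G.IsMesh H N → 2 * R₀ ≤ H →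
        ∀ (n : ℕ) (K : (Fin n → G.nodes → ℝ) →ₗ[ℝ] (Fin n → G.nodes → ℝ)) (α β : ℝ),
          G.OperatorAssumptions K α β →
          (∀ μ : ℝ, G.IsPoincareConstant R₀ μ → ((∃ i, 3 ≤ N i) ∨ 1 ≤ μ) →
            ∀ v ∈ G.vec n G.V, ∃ v₀ w, G.IsDecomposition H N v v₀ w ∧
              G.Ksq K v₀ + ∑ j, G.Ksq K (w j) ≤ C * β * α⁻¹ * σ * μ ^ 2 * G.Ksq K v) ∧
          (∀ v ∈ G.vec n G.V, ∀ v₀ w, G.IsDecomposition H N v v₀ w →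
            G.Ksq K v ≤ C * β * α⁻¹ * (G.Ksq K v₀ + ∑ j, G.Ksq K (w j))) := by
  have hs : 0 ≤ stabilityConst d := by
    unfold stabilityConst
    positivity
  have hA : (0 : ℝ) < 15 ^ d := by positivity
  refine ⟨stabilityConst d + 2 * 15 ^ d, by positivity, fun G R₀ σ ρ h =>
    ⟨exists_isPoincareConstant h, fun H N hm hR n K α β hK => ⟨?_, ?_⟩⟩⟩
  · intro μ hμ hN v hv
    choose v₀ hv₀ w hw hsum hle using fun i =>
      exists_scalar_decomposition h hm hR hμ hN (mem_vec.1 hv i)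
    have hv₀V : v₀ ∈ G.vec n G.V := mem_vec.2 fun i => VCoarse_le_V (hv₀ i)
    have hwV : ∀ k, (fun i => w i k) ∈ G.vec n G.V := fun k => mem_vec.2 fun i => (hw i k).1
    refine ⟨v₀, fun k i => w i k, ⟨mem_vec.2 hv₀, fun k => mem_vec.2 fun i => hw i k, ?_⟩, ?_⟩
    · ext i x
      have := congrFun (hsum i) x
      simpa using this
    · have hσ : 0 ≤ σ * μ ^ 2 :=
        mul_nonneg (zero_le_one.trans (one_le_sigma h hm hR)) (sq_nonneg _)
      have hb : 0 ≤ max β 0 := le_max_right _ _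
      have h1 : G.LsqVec v₀ + ∑ k, G.LsqVec (fun i => w i k) ≤
          stabilityConst d * (σ * μ ^ 2) * G.LsqVec v := by
        unfold LsqVec
        rw [Finset.sum_comm, ← Finset.sum_add_distrib, Finset.mul_sum]
        exact Finset.sum_le_sum fun i _ => hle i
      calc G.Ksq K v₀ + ∑ k, G.Ksq K (fun i => w i k)
          ≤ max β 0 * G.LsqVec v₀ + ∑ k, max β 0 * G.LsqVec (fun i => w i k) :=
            add_le_add (Ksq_le hK hv₀V) (Finset.sum_le_sum fun k _ => Ksq_le hK (hwV k))
        _ = max β 0 * (G.LsqVec v₀ + ∑ k, G.LsqVec (fun i => w i k)) := by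
            rw [← Finset.mul_sum, mul_add]
        _ ≤ max β 0 * (stabilityConst d * (σ * μ ^ 2) * G.LsqVec v) := by gcongr
        _ = stabilityConst d * (σ * μ ^ 2) * (max β 0 * G.LsqVec v) := by ring
        _ ≤ (stabilityConst d + 2 * 15 ^ d) * (σ * μ ^ 2) * (max β 0 * G.LsqVec v) := by
            have := LsqVec_nonneg v
            gcongr
            linarith
        _ ≤ (stabilityConst d + 2 * 15 ^ d) * (σ * μ ^ 2) * (β * α⁻¹ * G.Ksq K v) :=
            mul_le_mul_of_nonneg_left (max_mul_LsqVec_le hK hv)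
              (mul_nonneg (by linarith) hσ)
        _ = _ := by ring
  · rintro v hv v₀ w ⟨hv₀, hw, rfl⟩
    have hb : 0 ≤ max β 0 := le_max_right _ _
    have hv₀V : v₀ ∈ G.vec n G.V := mem_vec.2 fun i => VCoarse_le_V (mem_vec.1 hv₀ i)
    have hwV : ∀ k, w k ∈ G.vec n G.V := fun k => mem_vec.2 fun i => (mem_vec.1 (hw k) i).1
    have hw0 : 0 ≤ ∑ k, G.LsqVec (w k) := Finset.sum_nonneg fun k _ => LsqVec_nonneg (w k)
    have h1 : G.LsqVec (v₀ + ∑ k, w k) ≤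
        2 * 15 ^ d * (G.LsqVec v₀ + ∑ k, G.LsqVec (w k)) := by
      unfold LsqVec
      rw [Finset.sum_comm, ← Finset.sum_add_distrib, Finset.mul_sum]
      refine Finset.sum_le_sum fun i _ => ?_
      have := Lsq_add_sum_le h hm hR (v₀ i) (fun k => w k i) fun k => mem_vec.1 (hw k) i
      rwa [Pi.add_apply, Finset.sum_apply]
    calc G.Ksq K (v₀ + ∑ k, w k) ≤ max β 0 * G.LsqVec (v₀ + ∑ k, w k) := Ksq_le hK hv
      _ ≤ max β 0 * (2 * 15 ^ d * (G.LsqVec v₀ + ∑ k, G.LsqVec (w k))) :=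
          mul_le_mul_of_nonneg_left h1 hb
      _ ≤ max β 0 * ((stabilityConst d + 2 * 15 ^ d) *
          (G.LsqVec v₀ + ∑ k, G.LsqVec (w k))) := by
          have := LsqVec_nonneg v₀
          refine mul_le_mul_of_nonneg_left (mul_le_mul_of_nonneg_right ?_ (by linarith)) hb
          linarith
      _ = (stabilityConst d + 2 * 15 ^ d) *
          (max β 0 * G.LsqVec v₀ + ∑ k, max β 0 * G.LsqVec (w k)) := by
          rw [← Finset.mul_sum, ← mul_add, mul_left_comm]
      _ ≤ (stabilityConst d + 2 * 15 ^ d) *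
          (β * α⁻¹ * G.Ksq K v₀ + ∑ k, β * α⁻¹ * G.Ksq K (w k)) :=
          mul_le_mul_of_nonneg_left (add_le_add (max_mul_LsqVec_le hK hv₀V)
            (Finset.sum_le_sum fun k _ => max_mul_LsqVec_le hK (hwV k))) (by linarith)
      _ = _ := by
          rw [← Finset.mul_sum, ← mul_add, mul_assoc, mul_assoc, mul_assoc]
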